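/- Let $(R,\mathfrak m)$ be a one-dimensional reduced Noetherian local ring and $X=\operatorname{Spec} R$. Let $\overline R$ be the integral closure of $R$ in its total ring of fractions and let $\delta(X)=\operatorname{length}_R(\overline R/R)\in\mathbb N\cup\{\infty\}$. A resolution of singularities of $X$ is a proper morphism $\pi:Z\to X$, with $Z$ a regular scheme, such that the set $U=X\setminus\operatorname{Sing}(X)$ of regular points is open, $\pi^{-1}(U)$ is dense in $Z$, and $\pi$ is an isomorphism over $U$. For an $\mathfrak m$-primary ideal $I$, let $e_0(I),e_1(I)\in\mathbb Z$ be the normalized Hilbert–Samuel coefficients, i.e. the integers with $\operatorname{length}_R(R/I^{n+1})=e_0(I)(n+1)-e_1(I)$ for all $n\gg 0$. An ideal $I$ of $R$ is a Hironaka ideal if $V(I)=\operatorname{Sing}(X)$ and the blow-up $\operatorname{Proj}\big(\bigoplus_{n\ge 0}I^nt^n\big)\to X$ is a resolution of singularities of $X$. 1. The geometric genus $p_g(X)=\operatorname{length}_R\big(\Gamma(X,\pi_*\mathcal O_Z/\mathcal O_X)\big)=\operatorname{length}_R\big(\Gamma(Z,\mathcal O_Z)/R\big)$ equals $\delta(X)$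 for every resolution of singularities $\pi:Z\to X$. A resolution exists whenever $\delta(X)<\infty$, and $\delta(X)<\infty$ whenever $R$ is essentially of finite type over a field of characteristic zero. 2. For every $\mathfrak m$-primary ideal $I$ the integers $e_0(I),e_1(I)$ exist and are unique, and $0\le e_1(I)\le\delta(X)$. 3. Let $I$ be an $\mathfrak m$-primary ideal with $e_1(I)=\delta(X)$. Then the blow-up of $X$ at $I$ is a resolution of singularities of $X$; if moreover $R$ is not regular, then $I$ is a Hironaka ideal. -/

import Mathlib

open AlgebraicGeometry CategoryTheory Polynomial

universe u

/-- The degree `n` part `Iⁿ tⁿ` of the Rees algebra `⨁ₙ Iⁿ tⁿ ⊆ R[t]`. -/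
noncomputable def reesGrading {R : Type u} [CommRing R] (I : Ideal R) (n : ℕ) :
    Submodule R (reesAlgebra I) :=
  (LinearMap.range (monomial n : R →ₗ[R] R[X])).comap (reesAlgebra I).val.toLinearMap

theorem mem_reesGrading {R : Type u} [CommRing R] {I : Ideal R} {n : ℕ} {f : reesAlgebra I} :
    f ∈ reesGrading I n ↔ ∃ r : R, monomial n r = (f : R[X]) := Iff.rfl

/-- The homogeneous component of degree `n` of an element of the Rees algebra. -/
noncomputable def reesComponent {R : Type u} [CommRing R] (I : Ideal R) (f : reesAlgebra I)
    (n : ℕ) : reesGrading I n :=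
  ⟨⟨monomial n ((f : R[X]).coeff n), reesAlgebra.monomial_mem.mpr (f.2 n)⟩, ⟨_, rfl⟩⟩

noncomputable instance reesGradedAlgebra {R : Type u} [CommRing R] (I : Ideal R) :
    GradedAlgebra (reesGrading I) where
  one_mem := ⟨1, rfl⟩
  mul_mem := by
    rintro i j a b ⟨r, hr⟩ ⟨s, hs⟩
    refine ⟨r * s, ?_⟩
    rw [← monomial_mul_monomial, hr, hs]
    rfl
  decompose' f := ∑ n ∈ (f : R[X]).support, DirectSum.of (fun i => reesGrading I i) n
    (reesComponent I f n)
  left_inv f := by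
    ext1
    simp only [map_sum, DirectSum.coeAddMonoidHom_of]
    simp only [reesComponent, AddSubmonoidClass.coe_finsetSum]
    exact ((f : R[X]).as_sum_support).symm
  right_inv x := by
    classical
    have key : ∀ f : reesAlgebra I, ∀ m : ℕ,
        (∑ n ∈ (f : R[X]).support, DirectSum.of (fun i => reesGrading I i) n
          (reesComponent I f n)) m = reesComponent I f m := by
      intro f m
      rw [DFinsupp.finsetSum_apply, Finset.sum_eq_single m]
      · exact DirectSum.of_eq_same _ _
      · intro n _ hn
        exact DirectSum.of_eq_of_ne _ _ _ hn.symm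
      · intro hm
        rw [DirectSum.of_eq_same]
        ext
        simp [reesComponent, notMem_support_iff.mp hm]
    refine DFinsupp.ext fun m => (key _ m).trans ?_
    ext1
    ext1
    change monomial m (((DirectSum.coeAddMonoidHom (reesGrading I) x : reesAlgebra I) :
      R[X]).coeff m) = ((x m : reesAlgebra I) : R[X])
    induction x using DirectSum.induction_on with
    | zero => simp
    | of i y =>
      obtain ⟨r, hr⟩ := mem_reesGrading.mp y.2
      rw [DirectSum.coeAddMonoidHom_of, ← hr]
      by_cases h : i = m
      · subst h
        rw [DirectSum.of_eq_same, ← hr]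
        simp
      · rw [DirectSum.of_eq_of_ne _ _ _ (Ne.symm h)]
        simp [coeff_monomial, h]
    | add x y hx hy =>
      rw [map_add, DirectSum.add_apply]
      simp only [Subalgebra.coe_add, Submodule.coe_add, coeff_add, map_add, hx, hy]

/-- The blow-up `π : Proj(⨁ₙ Iⁿ tⁿ) ⟶ Spec R` of `Spec R` centred at `I`. -/
noncomputable def blowUpMap {R : Type u} [CommRing R] (I : Ideal R) :
    Proj (reesGrading I) ⟶ Spec (CommRingCat.of R) :=
  Proj.toSpecZero (reesGrading I) ≫
    Spec.map (CommRingCat.ofHom (algebraMap R (reesGrading I 0)))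

/-- The singular locus: the points whose local ring is not a regular local ring. -/
def singularLocus (X : Scheme.{u}) : Set X :=
  {x | ¬ IsRegularLocalRing (X.presheaf.stalk x)}

/-- `π : Z ⟶ X` is a resolution of singularities: `Z` is non-singular, `π` is proper and
birational, and `π` is an isomorphism over the complement of the singular locus of `X`
(which is open in `X`, with dense preimage in `Z`). -/
structure IsResolution {Z X : Scheme.{u}} (π : Z ⟶ X) : Prop where
  nonsingular : singularLocus Z = ∅
  proper : IsProper π
  iso_off_sing : ∃ U : X.Opens, (U : Set X) = (singularLocus X)ᶜ ∧
    Dense ((π ⁻¹ᵁ U : Z.Opens) : Set Z) ∧ IsIso (π ∣_ U)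

/-- `I` is a Hironaka ideal: `V(I)` is the singular locus of `Spec R`, and blowing up `I`
is a resolution of singularities of `Spec R`. -/
structure IsHironakaIdeal {R : Type u} [CommRing R] (I : Ideal R) : Prop where
  zeroLocus_eq : PrimeSpectrum.zeroLocus (I : Set R) = singularLocus (Spec (CommRingCat.of R))
  resolution : IsResolution (blowUpMap I)

/-- `e 0, …, e d` are the normalized Hilbert-Samuel coefficients of `I`, where `d = dim R`:
`length (R / I ^ (n + 1)) = ∑ i ≤ d, (-1) ^ i * e i * binom (n + d - i) (d - i)`
for all sufficiently large `n`. -/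
def IsHilbertSamuelCoeffs {R : Type u} [CommRing R] (d : ℕ) (I : Ideal R)
    (e : Fin (d + 1) → ℤ) : Prop :=
  ∀ᶠ n : ℕ in Filter.atTop, ∃ h : ℕ, Module.length R (R ⧸ I ^ (n + 1)) = (h : ℕ∞) ∧
    (h : ℤ) = ∑ i : Fin (d + 1), (-1) ^ (i : ℕ) * e i * ((n + d - i).choose (d - i) : ℤ)

/-- The singularity order `δ = length_R (R̄ / R)`, where `R̄` is the integral closure of `R` in
its total ring of fractions. -/
noncomputable def singularityOrder (R : Type u) [CommRing R] : ℕ∞ :=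
  Module.length R (integralClosure R (FractionRing R) ⧸
    LinearMap.range (Algebra.linearMap R (integralClosure R (FractionRing R))))

/-- The length over `R` of `Γ(Z, 𝒪_Z) / R`, the global sections of `π_* 𝒪_Z / 𝒪_X`, for a morphism
`π : Z ⟶ X = Spec R`. For `X` of dimension one and `π` a resolution of singularities, this is the
geometric genus of `X`. -/
noncomputable def genusOf {R : Type u} [CommRing R] {Z : Scheme.{u}}
    (π : Z ⟶ Spec (CommRingCat.of R)) : ℕ∞ :=
  letI : Algebra R Γ(Z, ⊤) :=
    ((Scheme.ΓSpecIso (CommRingCat.of R)).inv ≫ π.appTop).hom.toAlgebra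
  Module.length R (Γ(Z, ⊤) ⧸ LinearMap.range (Algebra.linearMap R Γ(Z, ⊤)))

/-! Everything is compared with the normalization R̄ inside the total fraction ring K. Since dim R =
1 and R is reduced, the maximal ideal contains a nonzerodivisor f, every other nonzerodivisor
divides a power of f, and so K = R_f. Geometrically, D(f) is the complement of the closed point.

Genus. On a resolution Z each stalk is regular of dimension at most one, hence a principal ideal
domain, because Z agrees with X over D(f) and the preimage of D(f) is dense. If R is singular,
restriction to that preimage embeds Γ(Z, 𝒪) into R_f = K. Properness makes global sections integral
over R. Conversely an integral element r/fⁿ lies in every stalk, so the local quotients glue. Hence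
Γ(Z, 𝒪) = R̄ (`exists_algEquiv_integralClosure`); if R is regular, π is an isomorphism and R = R̄.
When δ is finite, R̄ is finite over R and Spec R̄ is a resolution. In characteristic zero finiteness
of R̄ follows from Noether normalization and separability, after passing to the quotients by minimal
primes.

Hilbert coefficients. The residue field may be finite, so I itself need not have a principal
reduction, but some x ∈ I^d satisfies I^(m+d) = x I^m for large m
(`exists_pow_add_eq_span_mul_pow`). The algebra B = ⋃ x⁻ᵏ I^(dk) ⊆ K is then finite over R, and Spec
B is the blow-up of I. As B is semilocal and (IB)^d = xB, the ideal IB is principal, say yB. For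
large m one has I^m = y^m B, and counting the length of B/y^m B in two ways gives length(R/I^m) +
length(B/R) = m · length(B/yB). Thus e₁(I) = length(B/R). Since B ⊆ R̄, this is at most δ, and if it
equals δ then B = R̄, so that the blow-up is the normalization. -/

open IsLocalRing nonZeroDivisors

/-! ### Primes, lengths and fractions in a one-dimensional local ring -/

section OneDimensional

variable {R : Type u} [CommRing R] [IsLocalRing R]

theorem eq_maximalIdeal_of_lt (hdim : ringKrullDim R = 1) {Q P : Ideal R} [Q.IsPrime] [P.IsPrime]
    (h : Q < P) : P = maximalIdeal R := by
  by_contra hne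
  have h1 : P < maximalIdeal R := lt_of_le_of_ne (le_maximalIdeal Ideal.IsPrime.ne_top') hne
  have h2 := Ideal.height_add_one_le_of_lt_of_isPrime h
  have h3 := Ideal.height_add_one_le_of_lt_of_isPrime h1
  have h4 : (maximalIdeal R).height = 1 := by
    have := maximalIdeal_height_eq_ringKrullDim (R := R)
    rw [hdim] at this
    exact_mod_cast this
  rw [h4] at h3
  have h5 : (1 : ℕ∞) + 1 ≤ 1 := le_trans (add_le_add_left (le_trans (le_add_left le_rfl) h2) 1) h3
  exact absurd h5 (by decide)

theorem mem_minimalPrimes_of_ne_maximalIdeal (hdim : ringKrullDim R = 1) {P : Ideal R} [P.IsPrime]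
    (h : P ≠ maximalIdeal R) : P ∈ minimalPrimes R := by
  obtain ⟨Q, hQ, hQP⟩ := Ideal.exists_minimalPrimes_le (I := ⊥) (J := P) bot_le
  have := hQ.1.1
  rcases hQP.eq_or_lt with rfl | hlt
  · exact hQ
  · exact absurd (eq_maximalIdeal_of_lt hdim hlt) h

theorem maximalIdeal_notMem_minimalPrimes (hdim : ringKrullDim R = 1) :
    maximalIdeal R ∉ minimalPrimes R := by
  rw [← Ideal.height_eq_zero_iff]
  intro h
  have := maximalIdeal_height_eq_ringKrullDim (R := R)
  rw [hdim, h] at this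
  exact absurd this (by decide)

theorem eq_maximalIdeal_of_mem_nonZeroDivisors (hdim : ringKrullDim R = 1) {P : Ideal R} [P.IsPrime]
    {s : R} (hs : s ∈ R⁰) (h : s ∈ P) : P = maximalIdeal R := by
  by_contra hne
  exact notMem_nonZeroDivisors_of_mem_mem_minimalPrimes h
    (mem_minimalPrimes_of_ne_maximalIdeal hdim hne) hs

/-- If 𝔪 consisted of zero divisors, a single nonzero a would annihilate it. Then a ∈ 𝔪 gives a² =
0, against reducedness, and a unit a gives 𝔪 = 0, against dimension one. -/
theorem exists_mem_maximalIdeal_nonZeroDivisors [IsNoetherianRing R] [_root_.IsReduced R]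
    (hdim : ringKrullDim R = 1) : ∃ f ∈ maximalIdeal R, f ∈ R⁰ := by
  by_contra! hcon
  have hdis : Disjoint ((maximalIdeal R : Ideal R) : Set R) R⁰ :=
    Set.disjoint_left.mpr fun x hx hx' => hcon x hx hx'
  obtain ⟨a, ha, ha0⟩ := SetLike.exists_of_lt
    (Ideal.bot_lt_annihilator_of_disjoint_nonZeroDivisors hdis)
  rw [Submodule.mem_annihilator] at ha
  by_cases ham : a ∈ maximalIdeal R
  · have := ha a ham
    exact ha0 (by simpa using pow_eq_zero_iff (n := 2) two_ne_zero |>.mp (by simpa [sq] using this))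
  · have hu : IsUnit a := by simpa using ham
    have hbot : maximalIdeal R = ⊥ := by
      rw [eq_bot_iff]
      intro x hx
      have := ha x hx
      simpa using (hu.mul_right_eq_zero.mp this)
    have : maximalIdeal R ∈ minimalPrimes R :=
      ⟨⟨inferInstance, bot_le⟩, fun J _ _ => hbot ▸ bot_le⟩
    exact maximalIdeal_notMem_minimalPrimes hdim this

theorem maximalIdeal_le_radical_of_mem_nonZeroDivisors (hdim : ringKrullDim R = 1) {J : Ideal R}
    {s : R} (hs : s ∈ R⁰) (hsJ : s ∈ J) : maximalIdeal R ≤ J.radical := by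
  rw [Ideal.radical_eq_sInf]
  refine le_sInf fun P hP => ?_
  have := hP.2
  rw [eq_maximalIdeal_of_mem_nonZeroDivisors hdim hs (hP.1 hsJ)]

theorem isArtinianRing_quotient [IsNoetherianRing R] {J : Ideal R}
    (hJ : maximalIdeal R ≤ J.radical) : IsArtinianRing (R ⧸ J) := by
  rw [isArtinianRing_iff_isNoetherianRing_krullDimLE_zero]
  refine ⟨inferInstance, Ring.krullDimLE_zero_iff.mpr fun P hP => ?_⟩
  have h1 : P.comap (Ideal.Quotient.mk J) = maximalIdeal R := by
    refine le_antisymm (le_maximalIdeal Ideal.IsPrime.ne_top') (hJ.trans ?_)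
    refine (Ideal.IsPrime.radical_le_iff inferInstance).mpr ?_
    intro x hx
    simp [Ideal.mem_comap, Ideal.Quotient.eq_zero_iff_mem.mpr hx]
  have : (P.comap (Ideal.Quotient.mk J)).IsMaximal := h1 ▸ inferInstance
  rcases Ideal.map_eq_top_or_isMaximal_of_surjective (Ideal.Quotient.mk J)
    Ideal.Quotient.mk_surjective this with h | h
  · rw [Ideal.map_comap_of_surjective _ Ideal.Quotient.mk_surjective] at h
    exact absurd h hP.ne_top
  · rwa [Ideal.map_comap_of_surjective _ Ideal.Quotient.mk_surjective] at h

/-- M is a finite module over the Artinian ring R/J. -/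
theorem length_ne_top_of_smul_eq_zero [IsNoetherianRing R] {J : Ideal R}
    (hJ : maximalIdeal R ≤ J.radical) {M : Type*} [AddCommGroup M] [Module R M] [Module.Finite R M]
    (h : ∀ r ∈ J, ∀ x : M, r • x = 0) : Module.length R M ≠ ⊤ := by
  have hT : Module.IsTorsionBySet R M J := fun x r => h r r.2 x
  let := hT.module
  have : IsScalarTower R (R ⧸ J) M := hT.isScalarTower
  have := isArtinianRing_quotient hJ
  have : Module.Finite (R ⧸ J) M := Module.Finite.of_restrictScalars_finite R _ _
  rw [Module.length_eq_of_surjective (S := R) (M := M) (Ideal.Quotient.mk_surjective (I := J))]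
  exact Module.length_ne_top

/-- The localization of a reduced ring at a minimal prime is a field. -/
theorem isRegularLocalRing_of_mem_minimalPrimes {A : Type u} [CommRing A] [_root_.IsReduced A]
    {P : Ideal A} [P.IsPrime] (hP : P ∈ minimalPrimes A) (B : Type u) [CommRing B] [Algebra A B]
    [IsLocalization.AtPrime B P] : IsRegularLocalRing B := by
  have : IsLocalRing B := IsLocalization.AtPrime.isLocalRing B P
  have : _root_.IsReduced B := isReduced_localizationPreserves P.primeCompl B inferInstance
  have : IsField B := by
    have h := IsLocalization.AtPrime.radical_map_of_mem_minimalPrimes B P ⊥ hP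
    rw [isField_iff_maximalIdeal_eq, ← IsLocalization.AtPrime.map_eq_maximalIdeal P B, ← h,
      Ideal.map_bot]
    exact nilradical_eq_zero B
  let := this.toField
  infer_instance

theorem exists_dvd_pow_of_mem_nonZeroDivisors [IsNoetherianRing R] (hdim : ringKrullDim R = 1)
    {f s : R} (hf : f ∈ maximalIdeal R) (hs : s ∈ R⁰) : ∃ n : ℕ, s ∣ f ^ n := by
  obtain ⟨n, hn⟩ := maximalIdeal_le_radical_of_mem_nonZeroDivisors hdim hs
    (Ideal.mem_span_singleton_self s) hf
  exact ⟨n, Ideal.mem_span_singleton.mp hn⟩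

/-- Every nonzerodivisor divides a power of f, so inverting f inverts them all. This identifies K
with the functions on the punctured spectrum. -/
theorem isLocalization_away_fractionRing [IsNoetherianRing R] (hdim : ringKrullDim R = 1)
    {f : R} (hf : f ∈ maximalIdeal R) (hf0 : f ∈ R⁰) (K : Type*) [CommRing K] [Algebra R K]
    [IsFractionRing R K] : IsLocalization.Away f K where
  map_units := by
    rintro ⟨_, n, rfl⟩
    exact IsLocalization.map_units K (⟨f ^ n, pow_mem hf0 n⟩ : R⁰)
  surj z := by
    obtain ⟨⟨r, s⟩, h⟩ := IsLocalization.surj (M := R⁰) z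
    obtain ⟨n, t, ht⟩ := exists_dvd_pow_of_mem_nonZeroDivisors hdim hf s.2
    refine ⟨⟨r * t, ⟨f ^ n, n, rfl⟩⟩, ?_⟩
    simp only at h ⊢
    rw [ht, map_mul, map_mul, ← h]
    ring
  exists_of_eq h := ⟨1, by simpa using IsFractionRing.injective R K h⟩

end OneDimensional

/-! ### Lengths of subquotients -/

section RelativeLength

variable {R V W : Type*} [CommRing R] [AddCommGroup V] [Module R V] [AddCommGroup W] [Module R W]

/-- The length of `M / N` for submodules `N ≤ M` of an ambient module. -/
noncomputable def relLength (N M : Submodule R V) : ℕ∞ := Module.length R (M ⧸ N.submoduleOf M)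

theorem relLength_top (N : Submodule R V) : relLength N ⊤ = Module.length R (V ⧸ N) :=
  (Submodule.Quotient.equiv (N.submoduleOf ⊤) N Submodule.topEquiv (by
    rw [Submodule.submoduleOf]
    ext x
    simp)).length_eq

theorem relLength_add {N M L : Submodule R V} (h : N ≤ M) (h' : M ≤ L) :
    relLength N L = relLength N M + relLength M L := by
  have e : N.submoduleOf M ≤ (N.submoduleOf L).comap (Submodule.inclusion h') := fun x hx => hx
  refine Module.length_eq_add_of_exact
    (Submodule.mapQ _ _ (Submodule.inclusion h') e)
    (Submodule.factor (p := N.submoduleOf L) (p' := M.submoduleOf L)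
      fun x (hx : (x : V) ∈ N) => h hx)
    ?_ (Submodule.factor_surjective _) ?_
  · rw [← LinearMap.ker_eq_bot, Submodule.ker_mapQ, eq_bot_iff, Submodule.map_le_iff_le_comap]
    intro x hx
    rw [Submodule.mem_comap, Submodule.mem_bot]
    exact (Submodule.Quotient.mk_eq_zero _).mpr hx
  · rw [LinearMap.exact_iff, Submodule.range_mapQ, Submodule.range_inclusion]
    exact Submodule.ker_mapQ _ _ _ _

theorem relLength_map {g : V →ₗ[R] W} (hg : Function.Injective g) (N M : Submodule R V) :
    relLength (N.map g) (M.map g) = relLength N M := by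
  refine (Submodule.Quotient.equiv (N.submoduleOf M) _ (Submodule.equivMapOfInjective g hg M)
    ?_).length_eq.symm
  ext ⟨x, hx⟩
  obtain ⟨y, hy, rfl⟩ := hx
  simp only [Submodule.submoduleOf, Submodule.mem_map, Submodule.mem_comap, Submodule.subtype_apply]
  constructor
  · rintro ⟨z, hz, h⟩
    exact ⟨z, hz, congrArg Subtype.val h⟩
  · rintro ⟨z, hz, h⟩
    obtain rfl := hg h
    exact ⟨⟨z, hy⟩, hz, rfl⟩

theorem eq_of_relLength_eq_zero {N M : Submodule R V} (h : N ≤ M) (h0 : relLength N M = 0) :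
    N = M := by
  refine le_antisymm h fun x hx => ?_
  have := Module.length_eq_zero_iff.mp h0
  have := (Submodule.Quotient.mk_eq_zero (N.submoduleOf M) (x := ⟨x, hx⟩)).mp
    (Subsingleton.elim _ _)
  exact this

theorem relLength_self (N : Submodule R V) : relLength N N = 0 := by
  rw [relLength, Module.length_eq_zero_iff, Submodule.submoduleOf_self]
  infer_instance

end RelativeLength

/-! ### Regular local rings of dimension at most one -/

/-- If 𝔪 had height at least 2, prime avoidance and Krull's theorem would give x ∈ 𝔪 outside all
minimal primes and all primes minimal over s. A prime Q minimal over x is not minimal in B, so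
contains s. A prime minimal over s inside Q is strictly smaller than Q, hence has height 0, yet
contains s. -/
theorem height_maximalIdeal_le_one {B : Type*} [CommRing B] [IsLocalRing B] [IsNoetherianRing B]
    {s : B} (h1 : ∀ P ∈ minimalPrimes B, s ∉ P)
    (h2 : ∀ P : Ideal B, P.IsPrime → s ∉ P → P ∈ minimalPrimes B) :
    (maximalIdeal B).height ≤ 1 := by
  by_contra hcon
  have hfin : ((Ideal.span {s}).minimalPrimes ∪ minimalPrimes B).Finite :=
    (Ideal.finite_minimalPrimes_of_isNoetherianRing B _).union
      (Ideal.finite_minimalPrimes_of_isNoetherianRing B _)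
  have hx : ∃ x ∈ maximalIdeal B, ∀ P ∈ (Ideal.span {s}).minimalPrimes ∪ minimalPrimes B,
      x ∉ P := by
    by_contra! hx
    obtain ⟨P, hP, hle⟩ := ((maximalIdeal B).subset_union_prime_finite hfin (f := id) 0 0
      (by rintro P (hP | hP) _ _ <;> exact hP.1.1)).1 (fun x hx' => by simpa using hx x hx')
    have : P.IsPrime := by rcases hP with hP | hP <;> exact hP.1.1
    have hPm : P = maximalIdeal B := le_antisymm (le_maximalIdeal Ideal.IsPrime.ne_top') hle
    rcases hP with hP | hP
    · exact hcon (hPm ▸ Ideal.height_le_one_of_isPrincipal_of_mem_minimalPrimes _ _ hP)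
    · rw [← Ideal.height_eq_zero_iff, hPm] at hP
      simp [hP] at hcon
  obtain ⟨x, hxm, hx⟩ := hx
  obtain ⟨Q, hQ, -⟩ := Ideal.exists_minimalPrimes_le
    (show Ideal.span {x} ≤ maximalIdeal B by simpa [Ideal.span_le] using hxm)
  have hQp : Q.IsPrime := hQ.1.1
  have hxQ : x ∈ Q := hQ.1.2 (Ideal.mem_span_singleton_self x)
  have hQh := Ideal.height_le_one_of_isPrincipal_of_mem_minimalPrimes _ _ hQ
  have hsQ : s ∈ Q := by
    by_contra hs
    exact hx Q (.inr (h2 Q hQp hs)) hxQ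
  obtain ⟨P, hP, hPQ⟩ := Ideal.exists_minimalPrimes_le
    (show Ideal.span {s} ≤ Q by simpa [Ideal.span_le] using hsQ)
  have hPp : P.IsPrime := hP.1.1
  have hlt : P < Q := lt_of_le_of_ne hPQ (by rintro rfl; exact hx P (.inl hP) hxQ)
  have h3 := (Ideal.height_add_one_le_of_lt_of_isPrime hlt).trans hQh
  have h4 : P.height = 0 := by
    by_contra h
    have : (1 : ℕ∞) + 1 ≤ 1 := le_trans (add_le_add_left (Order.one_le_iff_pos.mpr
      (pos_iff_ne_zero.mpr h)) 1) h3
    exact absurd this (by decide)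
  exact h1 P (Ideal.height_eq_zero_iff.mp h4) (hP.1.2 (Ideal.mem_span_singleton_self s))

/-- Regularity makes 𝔪 = (x) principal. If 𝔪 is a minimal prime it is zero. Otherwise a minimal
prime Q omits x, so Q = 𝔪Q, and Nakayama gives Q = 0. -/
theorem IsRegularLocalRing.isDomain_and_isPrincipal_of_height_le_one {B : Type*} [CommRing B]
    [IsRegularLocalRing B] (h : (maximalIdeal B).height ≤ 1) :
    IsDomain B ∧ IsPrincipalIdealRing B := by
  have hreg := IsRegularLocalRing.spanFinrank_maximalIdeal (R := B)
  rw [← maximalIdeal_height_eq_ringKrullDim] at hreg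
  have hreg' : ((maximalIdeal B).spanFinrank : ℕ∞) = (maximalIdeal B).height := by
    exact_mod_cast hreg
  have hfg := (maximalIdeal B).fg_of_isNoetherianRing
  have hprin : (maximalIdeal B).IsPrincipal := by
    have hc : (maximalIdeal B).generators.ncard ≤ 1 := by
      rw [Submodule.FG.generators_ncard hfg]
      exact_mod_cast hreg'.trans_le h
    have hsub := (@Set.ncard_le_one_iff_subsingleton _ _ (Submodule.FG.finite_generators hfg).to_subtype).mp hc
    rcases hsub.eq_empty_or_singleton with he | ⟨x, hx⟩
    · have := (maximalIdeal B).span_generators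
      rw [he] at this
      exact ⟨0, by rw [← this]; simp⟩
    · have := (maximalIdeal B).span_generators
      rw [hx] at this
      exact ⟨x, this.symm⟩
  have hdom : IsDomain B := by
    by_cases hm : maximalIdeal B ∈ minimalPrimes B
    · rw [← Ideal.height_eq_zero_iff] at hm
      rw [hm] at hreg'
      have h0 : (maximalIdeal B).spanFinrank = 0 := by exact_mod_cast hreg'
      have : maximalIdeal B = ⊥ := (Submodule.spanFinrank_eq_zero_iff_eq_bot hfg).mp h0
      exact (isField_iff_maximalIdeal_eq.mpr this).isDomain
    · obtain ⟨Q, hQ, hQm⟩ := Ideal.exists_minimalPrimes_le (bot_le (a := maximalIdeal B))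
      have hQp : Q.IsPrime := hQ.1.1
      obtain ⟨x, hx⟩ := hprin
      have hxQ : x ∉ Q := by
        intro hxQ
        have : maximalIdeal B ≤ Q := by
          rw [hx]; simpa [Submodule.span_le] using hxQ
        exact hm (le_antisymm hQm this ▸ hQ)
      have : Q = ⊥ := by
        refine Submodule.eq_bot_of_le_smul_of_le_jacobson_bot (maximalIdeal B) Q
          Q.fg_of_isNoetherianRing ?_ (IsLocalRing.maximalIdeal_le_jacobson _)
        intro a ha
        have ham := hQm ha
        rw [hx] at ham
        obtain ⟨b, rfl⟩ := Submodule.mem_span_singleton.mp ham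
        have : x * b ∈ maximalIdeal B * Q := Ideal.mul_mem_mul
          (hx.ge (Submodule.mem_span_singleton_self x)) ((hQp.mem_or_mem ha).resolve_right hxQ)
        rwa [smul_eq_mul b x, mul_comm b x]
      exact IsDomain.of_bot_isPrime B (hbp := this ▸ hQp)
  exact ⟨hdom, (tfae_of_isNoetherianRing_of_isLocalRing_of_isDomain B |>.out 0 4).mpr hprin⟩

/-- An element of a commutative algebra which stabilizes a finitely generated submodule that
contains a unit is integral. -/
theorem isIntegral_of_smul_mem_of_isUnit {R A : Type*} [CommRing R] [CommRing A] [Algebra R A]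
    (N : Submodule R A) (hN : N.FG) {s : A} (hs : IsUnit s) (hsN : s ∈ N) {x : A}
    (hx : ∀ n ∈ N, x * n ∈ N) : IsIntegral R x := by
  let A' : Subalgebra R A :=
    { carrier := { x | ∀ n ∈ N, x * n ∈ N }
      mul_mem' := fun {a b} ha hb n hn => mul_assoc a b n ▸ ha _ (hb _ hn)
      one_mem' := fun n hn => (one_mul n).symm ▸ hn
      add_mem' := fun {a b} ha hb n hn => (add_mul a b n).symm ▸ N.add_mem (ha _ hn) (hb _ hn)
      zero_mem' := fun n _ => (zero_mul n).symm ▸ N.zero_mem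
      algebraMap_mem' := fun r n hn => (Algebra.smul_def r n) ▸ N.smul_mem r hn }
  let f : A' →ₐ[R] Module.End R N :=
    AlgHom.ofLinearMap
      { toFun := fun x => (LinearMap.mulLeft R (x : A)).restrict x.2
        map_add' := by intro x y; ext; exact add_mul _ _ _
        map_smul' := by intro r s; ext; exact smul_mul_assoc _ _ _ }
      (by ext; exact one_mul _)
      (by intro x y; ext; exact mul_assoc _ _ _)
  -- The unit s ∈ N makes the action on N faithful, so a Cayley–Hamilton relation on N already holds
  -- in A.
  have hf : Function.Injective f := by
    refine (injective_iff_map_eq_zero f).mpr fun y hy => Subtype.ext ?_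
    have h : (y : A) * s = 0 := congrArg Subtype.val (LinearMap.congr_fun hy ⟨s, hsN⟩)
    exact hs.mul_left_eq_zero.mp h
  have : Module.Finite R N := .of_fg hN
  obtain ⟨P, hP, hP0⟩ := LinearMap.exists_monic_and_aeval_eq_zero R (f ⟨x, hx⟩)
  have h : aeval (⟨x, hx⟩ : A') P = 0 := hf (by
    rw [map_zero, ← Polynomial.aeval_algHom_apply]
    exact hP0)
  refine ⟨P, hP, ?_⟩
  have := congrArg A'.val h
  rwa [map_zero, ← Polynomial.aeval_algHom_apply] at this

/-- In a Noetherian ring which is integrally closed in its localization away from a nonzerodivisor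
`s`, a maximal ideal minimal over `s` becomes principal after localization. -/
theorem isRegularLocalRing_of_integrallyClosed_away {A : Type u} {K : Type*} [CommRing A] [CommRing K]
    [Algebra A K] [IsNoetherianRing A] {s : A} (hs0 : s ∈ A⁰) (hs : IsUnit (algebraMap A K s))
    (hinj : Function.Injective (algebraMap A K))
    (hint : ∀ x : K, IsIntegral A x → x ∈ Set.range (algebraMap A K))
    {p : Ideal A} [hp : p.IsMaximal] (hmin : p ∈ (Ideal.span {s}).minimalPrimes) :
    IsRegularLocalRing (Localization.AtPrime p) := by
  have hsp : s ∈ p := hmin.1.2 (Ideal.mem_span_singleton_self s)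
  -- Being minimal over s, the prime p is associated to A/(s).
  obtain ⟨a, ha, hpa⟩ : ∃ a : A, a ∉ Ideal.span {s} ∧ ∀ x ∈ p, x * a ∈ Ideal.span {s} := by
    have h := Module.associatedPrimes.minimalPrimes_annihilator_subset_associatedPrimes A
      (A ⧸ Ideal.span {s}) (by rwa [Ideal.annihilator_quotient])
    obtain ⟨hpp, x, hx⟩ := isAssociatedPrime_iff.mp h
    obtain ⟨a, rfl⟩ := Ideal.Quotient.mk_surjective x
    refine ⟨a, fun h => hpp.ne_top ?_, fun y hy => ?_⟩
    · rw [hx, Ideal.Quotient.eq_zero_iff_mem.mpr h]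
      simp
    · rw [hx, Submodule.mem_colon_singleton] at hy
      rw [← Ideal.Quotient.eq_zero_iff_mem, map_mul]
      simpa [Algebra.smul_def] using hy
  obtain ⟨u, hu⟩ := hs.exists_right_inv
  -- This is x = a/s: it satisfies xp ⊆ A but x ∉ A.
  set x : K := algebraMap A K a * u with hx
  have hsx : algebraMap A K s * x = algebraMap A K a := by
    rw [hx]; linear_combination (algebraMap A K a) * hu
  have hxp : ∀ q ∈ p, ∃ b : A, algebraMap A K b = x * algebraMap A K q := by
    intro q hq
    obtain ⟨b, hb⟩ := Ideal.mem_span_singleton'.mp (hpa q hq)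
    refine ⟨b, ?_⟩
    have hb' := congrArg (algebraMap A K) hb
    rw [map_mul, map_mul] at hb'
    rw [hx]
    linear_combination u * hb' - algebraMap A K b * hu
  have hxA : x ∉ Set.range (algebraMap A K) := by
    rintro ⟨b, hb⟩
    rw [← hb, ← map_mul] at hsx
    exact ha (Ideal.mem_span_singleton.mpr ⟨b, (hinj hsx).symm⟩)
  -- If xp ⊆ p, then x would be integral over A and hence lie in A. So xq is a unit at p for some q
  -- ∈ p, and this q generates p locally.
  obtain ⟨q, hq, b, hb, hbp⟩ : ∃ q ∈ p, ∃ b : A, algebraMap A K b = x * algebraMap A K q ∧ b ∉ p := by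
    by_contra! hcon
    refine hxA (hint x ?_)
    refine isIntegral_of_smul_mem_of_isUnit (Submodule.map (Algebra.linearMap A K) p)
      (Submodule.FG.map _ p.fg_of_isNoetherianRing) hs ⟨s, hsp, rfl⟩ ?_
    rintro _ ⟨q, hq, rfl⟩
    obtain ⟨b, hb⟩ := hxp q hq
    exact ⟨b, hcon q hq b hb, hb⟩
  have hgen : maximalIdeal (Localization.AtPrime p) =
      Ideal.span {algebraMap A (Localization.AtPrime p) q} := by
    rw [← Localization.AtPrime.map_eq_maximalIdeal]
    refine le_antisymm (Ideal.map_le_iff_le_comap.mpr fun r hr => ?_)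
      ((Ideal.span_singleton_le_iff_mem _).mpr (Ideal.mem_map_of_mem _ hq))
    obtain ⟨c, hc⟩ := hxp r hr
    have hrb : r * b = c * q := hinj (by
      rw [map_mul, map_mul]
      linear_combination (algebraMap A K r) * hb - (algebraMap A K q) * hc)
    rw [Ideal.mem_comap, Ideal.mem_span_singleton]
    have hbu : IsUnit (algebraMap A (Localization.AtPrime p) b) :=
      IsLocalization.map_units (M := p.primeCompl) _ ⟨b, hbp⟩
    rw [← hbu.dvd_mul_right, ← map_mul, hrb, map_mul]
    exact Dvd.intro_left _ rfl
  refine IsRegularLocalRing.of_spanFinrank_maximalIdeal_le _ ?_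
  have h1 : (maximalIdeal (Localization.AtPrime p)).spanFinrank ≤ 1 := by
    rw [hgen]
    simpa using Submodule.spanFinrank_span_le_ncard_of_finite (R := Localization.AtPrime p)
      (Set.finite_singleton (algebraMap A (Localization.AtPrime p) q))
  have h2 : (1 : WithBot ℕ∞) ≤ ringKrullDim (Localization.AtPrime p) := by
    rw [IsLocalization.AtPrime.ringKrullDim_eq_height p]
    have := (Ideal.one_le_height_span_singleton_of_mem_nonZeroDivisors hs0).trans
      (Ideal.height_mono hmin.1.2)
    exact_mod_cast this
  exact le_trans (by exact_mod_cast h1) h2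

/-! ### The singular locus of an affine scheme -/

theorem isRegularLocalRing_stalk_Spec_iff {A : Type u} [CommRing A] (x : PrimeSpectrum A) :
    IsRegularLocalRing ((Spec (CommRingCat.of A)).presheaf.stalk x) ↔
      IsRegularLocalRing (Localization.AtPrime x.asIdeal) := by
  let e : (Spec.structureSheaf A).presheaf.stalk x ≃ₐ[A] Localization.AtPrime x.asIdeal :=
    IsLocalization.algEquiv x.asIdeal.primeCompl _ _
  exact ⟨fun h => @IsRegularLocalRing.of_ringEquiv _ _ h _ _ e.toRingEquiv,
    fun _ => .of_ringEquiv e.symm.toRingEquiv⟩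

theorem mem_singularLocus_Spec_iff {A : Type u} [CommRing A] (x : PrimeSpectrum A) :
    x ∈ singularLocus (Spec (CommRingCat.of A)) ↔
      ¬ IsRegularLocalRing (Localization.AtPrime x.asIdeal) :=
  not_congr (isRegularLocalRing_stalk_Spec_iff x)

theorem dense_basicOpen_of_mem_nonZeroDivisors {A : Type*} [CommRing A] {s : A} (hs : s ∈ A⁰) :
    Dense ((PrimeSpectrum.basicOpen s : TopologicalSpace.Opens (PrimeSpectrum A)) :
      Set (PrimeSpectrum A)) := by
  rw [PrimeSpectrum.isTopologicalBasis_basic_opens.dense_iff]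
  rintro _ ⟨g, rfl⟩ hg
  by_contra hcon
  rw [Set.not_nonempty_iff_eq_empty, ← TopologicalSpace.Opens.coe_inf, ← PrimeSpectrum.basicOpen_mul,
    TopologicalSpace.Opens.coe_eq_empty, PrimeSpectrum.basicOpen_eq_bot_iff] at hcon
  obtain ⟨n, hn⟩ := hcon
  rw [mul_pow, mul_right_mem_nonZeroDivisors_eq_zero_iff (pow_mem hs n)] at hn
  have : PrimeSpectrum.basicOpen g = ⊥ := (PrimeSpectrum.basicOpen_eq_bot_iff g).mpr ⟨n, hn⟩
  simp [this] at hg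

section

variable {R : Type u} [CommRing R] [IsLocalRing R]

theorem basicOpen_le_compl_singularLocus [_root_.IsReduced R] (hdim : ringKrullDim R = 1) {f : R}
    (hf : f ∈ maximalIdeal R) :
    ((PrimeSpectrum.basicOpen f : TopologicalSpace.Opens (PrimeSpectrum R)) :
      Set (PrimeSpectrum R)) ⊆ (singularLocus (Spec (CommRingCat.of R)))ᶜ := by
  intro x hx
  have hne : x.asIdeal ≠ maximalIdeal R := fun h => hx (h ▸ hf)
  have h := isRegularLocalRing_of_mem_minimalPrimes
    (mem_minimalPrimes_of_ne_maximalIdeal hdim hne) (Localization.AtPrime x.asIdeal)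
  exact fun hx => (mem_singularLocus_Spec_iff x).mp hx h

theorem closedPoint_mem_singularLocus_iff :
    closedPoint R ∈ singularLocus (Spec (CommRingCat.of R)) ↔ ¬ IsRegularLocalRing R := by
  refine not_congr ?_
  let e := (stalkClosedPointIso (.of R)).commRingCatIsoToRingEquiv
  exact ⟨fun h => .of_ringEquiv e, fun h => .of_ringEquiv e.symm⟩

theorem singularLocus_Spec_of_not_isRegularLocalRing [_root_.IsReduced R]
    (hdim : ringKrullDim R = 1) (h : ¬ IsRegularLocalRing R) :
    singularLocus (Spec (CommRingCat.of R)) = {closedPoint R} := by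
  refine Set.Subset.antisymm (fun (x : PrimeSpectrum R) hx => ?_)
    (Set.singleton_subset_iff.mpr (closedPoint_mem_singularLocus_iff.mpr h))
  by_contra hne
  have hne' : x.asIdeal ≠ maximalIdeal R := fun h => hne (PrimeSpectrum.ext h)
  obtain ⟨f, hf, hfx⟩ : ∃ f ∈ maximalIdeal R, f ∉ x.asIdeal := by
    by_contra! hcon
    exact hne' (le_antisymm (le_maximalIdeal Ideal.IsPrime.ne_top') hcon)
  exact basicOpen_le_compl_singularLocus hdim hf hfx hx

theorem singularLocus_Spec_of_isRegularLocalRing [_root_.IsReduced R]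
    (hdim : ringKrullDim R = 1) (h : IsRegularLocalRing R) :
    singularLocus (Spec (CommRingCat.of R)) = ∅ := by
  refine Set.eq_empty_of_forall_notMem fun (x : PrimeSpectrum R) hx => ?_
  by_cases hne : x.asIdeal = maximalIdeal R
  · obtain rfl : x = closedPoint R := PrimeSpectrum.ext hne
    exact closedPoint_mem_singularLocus_iff.mp hx h
  · obtain ⟨f, hf, hfx⟩ : ∃ f ∈ maximalIdeal R, f ∉ x.asIdeal := by
      by_contra! hcon
      exact hne (le_antisymm (le_maximalIdeal Ideal.IsPrime.ne_top') hcon)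
    exact basicOpen_le_compl_singularLocus hdim hf hfx hx

theorem basicOpen_eq_compl_closedPoint [IsNoetherianRing R] (hdim : ringKrullDim R = 1) {f : R}
    (hf : f ∈ maximalIdeal R) (hf0 : f ∈ R⁰) :
    ((PrimeSpectrum.basicOpen f : TopologicalSpace.Opens (PrimeSpectrum R)) :
      Set (PrimeSpectrum R)) = {closedPoint R}ᶜ := by
  ext x
  simp only [SetLike.mem_coe, PrimeSpectrum.mem_basicOpen, Set.mem_compl_iff,
    Set.mem_singleton_iff, not_iff_not]
  refine ⟨fun h => PrimeSpectrum.ext (eq_maximalIdeal_of_mem_nonZeroDivisors hdim hf0 h), ?_⟩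
  rintro rfl
  exact hf

/-- A one-dimensional regular local ring is integrally closed. -/
theorem bijective_algebraMap_integralClosure (hdim : ringKrullDim R = 1)
    (h : IsRegularLocalRing R) :
    Function.Bijective (algebraMap R (integralClosure R (FractionRing R))) := by
  have hh : (maximalIdeal R).height ≤ 1 := by
    have := maximalIdeal_height_eq_ringKrullDim (R := R)
    rw [hdim] at this
    exact le_of_eq (by exact_mod_cast this)
  obtain ⟨_, _⟩ := IsRegularLocalRing.isDomain_and_isPrincipal_of_height_le_one hh
  have := IsIntegrallyClosed.integralClosure_eq_bot R (FractionRing R)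
  refine ⟨FaithfulSMul.algebraMap_injective _ _, ?_⟩
  rintro ⟨x, hx⟩
  rw [this] at hx
  obtain ⟨r, hr⟩ := Algebra.mem_bot.mp hx
  exact ⟨r, Subtype.ext hr⟩

end

theorem IsResolution.iso_comp {Z Z' X : Scheme.{u}} (e : Z' ≅ Z) {π : Z ⟶ X}
    (h : IsResolution π) : IsResolution (e.hom ≫ π) where
  nonsingular := by
    refine Set.eq_empty_of_forall_notMem fun z hz => ?_
    have h1 : IsRegularLocalRing (Z.presheaf.stalk (e.hom z)) := by
      by_contra hcon
      have : e.hom z ∈ singularLocus Z := hcon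
      rw [h.nonsingular] at this
      exact this
    exact hz (IsRegularLocalRing.of_ringEquiv
      (asIso (e.hom.stalkMap z)).commRingCatIsoToRingEquiv)
  proper := by
    have := h.proper
    infer_instance
  iso_off_sing := by
    obtain ⟨U, hU, hd, hi⟩ := h.iso_off_sing
    refine ⟨U, hU, ?_, ?_⟩
    · exact hd.preimage e.hom.homeomorph.isOpenMap
    · rw [morphismRestrict_comp]
      have h1 : IsIso (e.hom ∣_ (π ⁻¹ᵁ U)) := inferInstance
      exact IsIso.comp_isIso' h1 hi

/-! ### The spectrum of a finite normalization -/

section Normalization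

theorem isReduced_fractionRing {R : Type u} [CommRing R] [_root_.IsReduced R] :
    _root_.IsReduced (FractionRing R) :=
  isReduced_localizationPreserves R⁰ _ inferInstance

variable {R : Type u} [CommRing R] [IsLocalRing R] [IsNoetherianRing R]

/-- Primes containing f are maximal, as they lie over 𝔪, and the criterion for rings integrally
closed in their localization applies to them. The other primes are minimal by incomparability, so
their localizations are fields. The ring A is only isomorphic to R̄ so that the blow-up algebra can
take its place. -/
theorem isRegularLocalRing_localization_of_algEquiv_integralClosure [_root_.IsReduced R]
    {A : Type u} [CommRing A]
    [Algebra R A] [Module.Finite R A]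
    (hdim : ringKrullDim R = 1)
    (e : A ≃ₐ[R] integralClosure R (FractionRing R)) (p : Ideal A) [hp : p.IsPrime] :
    IsRegularLocalRing (Localization.AtPrime p) := by
  obtain ⟨f, hf, hf0⟩ := exists_mem_maximalIdeal_nonZeroDivisors hdim
  let ι : A →ₐ[R] FractionRing R := (integralClosure R (FractionRing R)).val.comp e.toAlgHom
  have hι : Function.Injective ι := Subtype.val_injective.comp e.injective
  have := isReduced_fractionRing (R := R)
  have hAred : _root_.IsReduced A := isReduced_of_injective ι hι
  have hAnoeth : IsNoetherianRing A := IsNoetherianRing.of_finite R A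
  let := ι.toRingHom.toAlgebra
  have hs : IsUnit (algebraMap A (FractionRing R) (algebraMap R A f)) := by
    have : algebraMap A (FractionRing R) (algebraMap R A f) = algebraMap R _ f := ι.commutes f
    rw [this]
    exact IsLocalization.map_units (FractionRing R) (⟨f, hf0⟩ : R⁰)
  have hs0 : algebraMap R A f ∈ A⁰ :=
    mem_nonZeroDivisors_of_injective (f := ι) hι hs.mem_nonZeroDivisors
  have hmax : ∀ q : Ideal A, q.IsPrime → algebraMap R A f ∈ q → q.IsMaximal := by
    intro q hq hfq
    refine Ideal.isMaximal_of_isIntegral_of_isMaximal_comap (R := R) q ?_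
    rw [eq_maximalIdeal_of_mem_nonZeroDivisors hdim hf0 (P := q.comap (algebraMap R A)) hfq]
    infer_instance
  by_cases hfp : algebraMap R A f ∈ p
  · have := hmax p hp hfp
    refine isRegularLocalRing_of_integrallyClosed_away (K := FractionRing R) hs0 hs hι ?_ ?_
    · intro x hx
      have : IsScalarTower R A (FractionRing R) := IsScalarTower.of_algebraMap_eq fun r =>
        (ι.commutes r).symm
      have hxR : IsIntegral R x := isIntegral_trans x hx
      exact ⟨e.symm ⟨x, hxR⟩, by
        change (e (e.symm ⟨x, hxR⟩) : FractionRing R) = x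
        rw [AlgEquiv.apply_symm_apply]⟩
    · refine ⟨⟨hp, by simpa [Ideal.span_le] using hfp⟩, fun q hq hqp => ?_⟩
      have hq' := hmax q hq.1 (hq.2 (Ideal.mem_span_singleton_self _))
      exact (hq'.eq_of_le hp.ne_top hqp).ge
  · refine isRegularLocalRing_of_mem_minimalPrimes ⟨⟨hp, bot_le⟩, fun q hq hqp => ?_⟩ _
    by_contra hpq
    have := hq.1
    have hlt : q < p := lt_of_le_not_ge hqp hpq
    have h2 := Ideal.IsIntegral.comap_lt_comap (R := R) hlt
    have := eq_maximalIdeal_of_lt hdim h2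
    exact hfp (this.ge hf : f ∈ p.comap (algebraMap R A))

/-- R_f → A_f → K is an isomorphism, and A_f → K is injective. -/
theorem bijective_awayMap_of_injective_fractionRing {A : Type u} [CommRing A] [Algebra R A]
    (hdim : ringKrullDim R = 1) {f : R}
    (hf : f ∈ maximalIdeal R) (hf0 : f ∈ R⁰) (ι : A →ₐ[R] FractionRing R)
    (hι : Function.Injective ι) :
    Function.Bijective (Localization.awayMap (algebraMap R A) f) := by
  have := isLocalization_away_fractionRing hdim hf hf0 (FractionRing R)
  let := ι.toRingHom.toAlgebra
  have hs : IsUnit (ι (algebraMap R A f)) := by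
    rw [ι.commutes]
    exact IsLocalization.map_units (FractionRing R) (⟨f, hf0⟩ : R⁰)
  let g : Localization.Away (algebraMap R A f) →+* FractionRing R :=
    IsLocalization.Away.lift (algebraMap R A f) hs
  have hg : Function.Injective g := by
    refine (IsLocalization.lift_injective_iff _).mpr fun x y => ?_
    refine Iff.trans ⟨fun h => ?_, congrArg _⟩ hι.eq_iff.symm
    obtain ⟨⟨_, n, rfl⟩, hn⟩ := IsLocalization.exists_of_eq (M := Submonoid.powers
      (algebraMap R A f)) h
    have h2 := congrArg ι hn
    simp only [map_mul, map_pow] at h2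
    exact hι ((hs.pow n).mul_left_cancel h2)
  have hcomp : Function.Bijective (g.comp (Localization.awayMap (algebraMap R A) f)) := by
    have : g.comp (Localization.awayMap (algebraMap R A) f) =
      (IsLocalization.algEquiv (Submonoid.powers f) (Localization.Away f)
        (FractionRing R)).toAlgHom.toRingHom := by
      refine IsLocalization.ringHom_ext (Submonoid.powers f) (RingHom.ext fun r => ?_)
      simp [g, Localization.awayMap, IsLocalization.Away.map]
    rw [this]
    exact AlgEquiv.bijective _
  refine ⟨fun x y h => hcomp.1 (congrArg g h), fun y => ?_⟩
  obtain ⟨x, hx⟩ := hcomp.2 (g y)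
  exact ⟨x, hg hx⟩

/-- If the normalization of a one-dimensional reduced Noetherian local ring is finite, then its
spectrum is a resolution of singularities. -/
theorem isResolution_specMap_of_algEquiv_integralClosure [_root_.IsReduced R] {A : Type u} [CommRing A] [Algebra R A]
    [Module.Finite R A]
    (hdim : ringKrullDim R = 1) (e : A ≃ₐ[R] integralClosure R (FractionRing R)) :
    IsResolution (Spec.map (CommRingCat.ofHom (algebraMap R A))) where
  nonsingular := Set.eq_empty_of_forall_notMem fun (x : PrimeSpectrum A) hx => hx <|
    (isRegularLocalRing_stalk_Spec_iff x).mpr <|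
      isRegularLocalRing_localization_of_algEquiv_integralClosure hdim e x.asIdeal
  proper := by
    have : IsFinite (Spec.map (CommRingCat.ofHom (algebraMap R A))) := by
      rw [IsFinite.SpecMap_iff]
      exact RingHom.finite_algebraMap.mpr inferInstance
    infer_instance
  iso_off_sing := by
    -- The open set must be exactly the regular locus: all of Spec R in the regular case, where A =
    -- R, and D(f) otherwise.
    by_cases hreg : IsRegularLocalRing R
    · have hb : Function.Bijective (algebraMap R A) := by
        have h1 := bijective_algebraMap_integralClosure hdim hreg
        have : (algebraMap R A : R → A) = e.symm ∘ algebraMap R _ := by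
          ext r; exact (e.symm.commutes r).symm
        rw [this]
        exact e.symm.bijective.comp h1
      have : IsIso (Spec.map (CommRingCat.ofHom (algebraMap R A))) := isIso_SpecMap_iff.mpr hb
      refine ⟨⊤, ?_, ?_, ?_⟩
      · rw [singularLocus_Spec_of_isRegularLocalRing hdim hreg]; simp
      · simp
      · infer_instance
    · obtain ⟨f, hf, hf0⟩ := exists_mem_maximalIdeal_nonZeroDivisors hdim
      let ι : A →ₐ[R] FractionRing R := (integralClosure R (FractionRing R)).val.comp e.toAlgHom
      have hι : Function.Injective ι := Subtype.val_injective.comp e.injective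
      refine ⟨PrimeSpectrum.basicOpen f, ?_, ?_, ?_⟩
      · rw [singularLocus_Spec_of_not_isRegularLocalRing hdim hreg]
        exact basicOpen_eq_compl_closedPoint hdim hf hf0
      · have hs0 : algebraMap R A f ∈ A⁰ := by
          refine mem_nonZeroDivisors_of_injective (f := ι) hι (IsUnit.mem_nonZeroDivisors ?_)
          rw [ι.commutes]
          exact IsLocalization.map_units (FractionRing R) (⟨f, hf0⟩ : R⁰)
        exact dense_basicOpen_of_mem_nonZeroDivisors hs0
      · have hb := bijective_awayMap_of_injective_fractionRing hdim hf hf0 ι hι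
        refine ((MorphismProperty.isomorphisms Scheme).arrow_mk_iso_iff
          (SpecMapRestrictBasicOpenIso (CommRingCat.ofHom (algebraMap R A)) f)).mpr ?_
        exact isIso_SpecMap_iff.mpr hb

end Normalization

/-! ### Dividing global sections stalk by stalk -/

theorem eq_of_mul_eq_mul_of_germ_ne_zero {Z : Scheme.{u}} [hdom : ∀ z : Z, IsDomain (Z.presheaf.stalk z)]
    {t : Γ(Z, ⊤)} (ht : ∀ z : Z, Z.presheaf.germ ⊤ z trivial t ≠ 0) {U : Z.Opens} {b c : Γ(Z, U)}
    (h : Z.presheaf.map (homOfLE le_top).op t * b = Z.presheaf.map (homOfLE le_top).op t * c) :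
    b = c := by
  refine TopCat.Presheaf.section_ext Z.sheaf U b c fun z hz => ?_
  have h1 := congrArg (Z.presheaf.germ U z hz) h
  rw [map_mul, map_mul, TopCat.Presheaf.germ_res_apply] at h1
  have h2 : Z.presheaf.germ U z hz b = Z.presheaf.germ U z hz c := mul_left_cancel₀ (ht z) h1
  exact h2

/-- Local quotients a/t are unique, because t is nonzero in every stalk and the stalks are domains;
hence they glue. -/
theorem dvd_of_germ_dvd {Z : Scheme.{u}} [hdom : ∀ z : Z, IsDomain (Z.presheaf.stalk z)]
    {t a : Γ(Z, ⊤)} (ht : ∀ z : Z, Z.presheaf.germ ⊤ z trivial t ≠ 0)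
    (h : ∀ z : Z, Z.presheaf.germ ⊤ z trivial t ∣ Z.presheaf.germ ⊤ z trivial a) : t ∣ a := by
  have hloc : ∀ z : Z, ∃ (U : Z.Opens) (_ : z ∈ U) (b : Γ(Z, U)),
      Z.presheaf.map (homOfLE le_top).op a = Z.presheaf.map (homOfLE le_top).op t * b := by
    intro z
    obtain ⟨b, hb⟩ := h z
    obtain ⟨W, hzW, b, rfl⟩ := Z.presheaf.exists_germ_eq b
    have h1 : Z.presheaf.germ W z hzW (Z.presheaf.map (homOfLE le_top).op a) =
        Z.presheaf.germ W z hzW (Z.presheaf.map (homOfLE le_top).op t * b) := by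
      rw [map_mul, TopCat.Presheaf.germ_res_apply, TopCat.Presheaf.germ_res_apply]
      exact hb
    obtain ⟨V, hzV, i, j, h2⟩ := Z.presheaf.germ_eq z hzW hzW _ _ h1
    refine ⟨V, hzV, Z.presheaf.map j.op b, ?_⟩
    have h3 := h2
    rw [map_mul] at h3
    simp only [← ConcreteCategory.comp_apply, ← Functor.map_comp] at h3
    exact h3
  choose U hU b hb using hloc
  obtain ⟨(s : Γ(Z, ⊤)), hs, -⟩ := Z.sheaf.existsUnique_gluing' U ⊤ (fun z => homOfLE le_top)
    (fun z _ => TopologicalSpace.Opens.mem_iSup.mpr ⟨z, hU z⟩) b (by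
      intro z w
      refine eq_of_mul_eq_mul_of_germ_ne_zero ht ?_
      have h1 := congrArg (Z.presheaf.map (TopologicalSpace.Opens.infLELeft (U z) (U w)).op) (hb z)
      have h2 := congrArg (Z.presheaf.map (TopologicalSpace.Opens.infLERight (U z) (U w)).op) (hb w)
      rw [map_mul] at h1 h2
      simp only [← ConcreteCategory.comp_apply, ← Functor.map_comp] at h1 h2
      exact h1.symm.trans h2)
  refine ⟨s, ?_⟩
  refine TopCat.Presheaf.section_ext Z.sheaf ⊤ _ _ fun z hz => ?_
  change Z.presheaf.germ ⊤ z hz a = Z.presheaf.germ ⊤ z hz (t * s)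
  have h1 := congrArg (Z.presheaf.germ (U z) z (hU z)) (hb z)
  have h2 : Z.presheaf.map (homOfLE le_top).op s = b z := hs z
  rw [← h2, map_mul, TopCat.Presheaf.germ_res_apply, TopCat.Presheaf.germ_res_apply,
    TopCat.Presheaf.germ_res_apply] at h1
  rw [map_mul]
  exact h1

theorem isLocalization_away_of_ringEquiv {R R' S E : Type*} [CommRing R] [CommRing R'] [CommRing S]
    [CommRing E] [Algebra R' S] [Algebra R E] (e : R ≃+* R') (k : S ≃+* E) (f : R)
    [h : IsLocalization.Away (e f) S] (hk : ∀ r, algebraMap R E r = k (algebraMap R' S (e r))) :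
    IsLocalization.Away f E where
  map_units := by
    rintro ⟨_, n, rfl⟩
    rw [hk]
    refine IsUnit.map k ?_
    simpa using (IsLocalization.Away.algebraMap_isUnit (S := S) (e f)).pow n
  surj z := by
    obtain ⟨⟨r, _, n, rfl⟩, hr⟩ := IsLocalization.surj (M := Submonoid.powers (e f)) (k.symm z)
    refine ⟨⟨e.symm r, ⟨f ^ n, n, rfl⟩⟩, ?_⟩
    have := congrArg k hr
    simp only [map_mul, RingEquiv.apply_symm_apply] at this
    simp only [hk, RingEquiv.apply_symm_apply, ← this, map_pow]
  exists_of_eq {x y} hxy := by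
    rw [hk, hk, k.injective.eq_iff] at hxy
    obtain ⟨⟨_, n, rfl⟩, hn⟩ := IsLocalization.exists_of_eq (M := Submonoid.powers (e f)) hxy
    refine ⟨⟨f ^ n, n, rfl⟩, e.injective ?_⟩
    simpa using hn

/-! ### Structure maps of a scheme over Spec R -/

section Resolution

theorem finite_integralClosure_of_singularityOrder_ne_top {R : Type u} [CommRing R]
    (h : singularityOrder R ≠ ⊤) :
    Module.Finite R (integralClosure R (FractionRing R)) := by
  let C := integralClosure R (FractionRing R)
  let N := LinearMap.range (Algebra.linearMap R C)
  have h1 : Module.Finite R (C ⧸ N) := by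
    have := (isFiniteLength_iff_isNoetherian_isArtinian.mp (Module.length_ne_top_iff.mp h)).1
    exact inferInstanceAs (Module.Finite R (_ ⧸ _))
  have h2 : Module.Finite R N := inferInstance
  exact Module.Finite.of_submodule_quotient N

variable {R : Type u} [CommRing R] {Z : Scheme.{u}} (π : Z ⟶ Spec (CommRingCat.of R))

/-- The structure map on global sections. -/
noncomputable def globalSectionsMap : R →+* Γ(Z, ⊤) :=
  ((Scheme.ΓSpecIso (CommRingCat.of R)).inv ≫ π.appTop).hom

/-- The structure map to a stalk. -/
noncomputable def toStalkMap (z : Z) : R →+* Z.presheaf.stalk z :=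
  (Z.presheaf.germ ⊤ z trivial).hom.comp (globalSectionsMap π)

theorem fromSpecStalk_comp (z : Z) :
    Z.fromSpecStalk z ≫ π = Spec.map (CommRingCat.ofHom (toStalkMap π z)) := by
  refine ext_of_isAffine ?_
  rw [Scheme.Hom.comp_appTop, Scheme.fromSpecStalk_appTop]
  have h := Scheme.ΓSpecIso_inv_naturality (CommRingCat.ofHom (toStalkMap π z))
  have h2 : CommRingCat.ofHom (toStalkMap π z) = (Scheme.ΓSpecIso (CommRingCat.of R)).inv ≫
    π.appTop ≫ Z.presheaf.germ ⊤ z trivial := rfl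
  rw [h2, Category.assoc, Iso.cancel_iso_inv_left, ← h2] at h
  rw [← h]
  simp

/-- Primes of the stalk are the generizations of z, and on them π acts by contraction to R. -/
theorem comp_fromSpecStalk_apply (z : Z) (P : Spec (Z.presheaf.stalk z)) :
    π (Z.fromSpecStalk z P) = PrimeSpectrum.comap (toStalkMap π z) P := by
  rw [← Scheme.Hom.comp_apply, fromSpecStalk_comp]
  rfl

/-- The basic open subset of the spectrum defined by `f`, as an open subscheme. -/
noncomputable def specBasicOpen (f : R) : (Spec (CommRingCat.of R)).Opens :=
  (Spec (CommRingCat.of R)).basicOpen ((Scheme.ΓSpecIso (CommRingCat.of R)).inv f)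

theorem specBasicOpen_eq (f : R) : specBasicOpen f = PrimeSpectrum.basicOpen f :=
  basicOpen_eq_of_affine (R := CommRingCat.of R) f

theorem preimage_specBasicOpen (f : R) :
    π ⁻¹ᵁ (specBasicOpen f) = Z.basicOpen (globalSectionsMap π f) :=
  Scheme.preimage_basicOpen _ _

theorem mem_preimage_specBasicOpen_iff (f : R) (z : Z) :
    z ∈ π ⁻¹ᵁ (specBasicOpen f) ↔ IsUnit (toStalkMap π z f) := by
  rw [preimage_specBasicOpen, Scheme.mem_basicOpen_top]
  rfl

theorem isIso_app_of_isIso_morphismRestrict {X : Scheme.{u}} (p : Z ⟶ X) (U : X.Opens)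
    [hp : IsIso (p ∣_ U)] : IsIso (p.app U) := by
  have h : IsIso (Scheme.Hom.appTop (p ∣_ U)) := inferInstanceAs (IsIso ((p ∣_ U).app ⊤))
  rw [morphismRestrict_appTop] at h
  have h1 : IsIso (p.app (U.ι ''ᵁ ⊤)) :=
    @IsIso.of_isIso_comp_right _ _ _ _ _ _ _ (Functor.map_isIso _ _) h
  rwa [Scheme.Opens.ι_image_top] at h1

theorem injOn_of_isIso_morphismRestrict {X : Scheme.{u}} (p : Z ⟶ X) (U : X.Opens)
    [IsIso (p ∣_ U)] : Set.InjOn p (p ⁻¹ᵁ U : Z.Opens) := by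
  intro z hz w hw h
  let z' : (p ⁻¹ᵁ U).toScheme := ⟨z, hz⟩
  let w' : (p ⁻¹ᵁ U).toScheme := ⟨w, hw⟩
  have h1 : (p ∣_ U) z' = (p ∣_ U) w' :=
    Subtype.ext ((morphismRestrict_base_coe p U z').trans
      (h.trans (morphismRestrict_base_coe p U w').symm))
  exact congrArg Subtype.val ((p ∣_ U).homeomorph.injective h1)

/-- The structure map to the sections over the preimage of a basic open subset. -/
noncomputable def basicOpenSectionsMap (f : R) : R →+* Γ(Z, π ⁻¹ᵁ (specBasicOpen f)) :=
  (Z.presheaf.map (homOfLE le_top).op).hom.comp (globalSectionsMap π)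

theorem isLocalization_away_basicOpenSections (f : R) [IsIso (π ∣_ specBasicOpen f)] :
    letI := (basicOpenSectionsMap π f).toAlgebra
    IsLocalization.Away f Γ(Z, π ⁻¹ᵁ (specBasicOpen f)) := by
  have hi := isIso_app_of_isIso_morphismRestrict π (specBasicOpen f)
  let g : Γ(Spec (CommRingCat.of R), ⊤) := (Scheme.ΓSpecIso (CommRingCat.of R)).inv f
  have h1 : IsLocalization.Away g Γ(Spec (CommRingCat.of R), (Spec (CommRingCat.of R)).basicOpen g) :=
    (isAffineOpen_top (Spec (CommRingCat.of R))).isLocalization_basicOpen g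
  let e : R ≃+* Γ(Spec (CommRingCat.of R), ⊤) :=
    (Scheme.ΓSpecIso (CommRingCat.of R)).symm.commRingCatIsoToRingEquiv
  let k : Γ(Spec (CommRingCat.of R), (Spec (CommRingCat.of R)).basicOpen g) ≃+*
    Γ(Z, π ⁻¹ᵁ (specBasicOpen f)) := (asIso (π.app (specBasicOpen f))).commRingCatIsoToRingEquiv
  let := (basicOpenSectionsMap π f).toAlgebra
  refine isLocalization_away_of_ringEquiv e k f (h := h1) fun r => ?_
  have h2 := ConcreteCategory.congr_hom (π.naturality
    (homOfLE (le_top : specBasicOpen f ≤ ⊤)).op) ((Scheme.ΓSpecIso (CommRingCat.of R)).inv r)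
  exact h2.symm

end Resolution

/-! ### Stalks and global sections of a resolution -/

section Resolution

variable {R : Type u} [CommRing R] {Z : Scheme.{u}} (π : Z ⟶ Spec (CommRingCat.of R))

/-- Otherwise fy is nilpotent near z for some non-nilpotent germ y. The nonempty open set where y is
invertible meets the dense preimage of D(f), and there fy is both a unit and nilpotent. -/
theorem toStalkMap_notMem_of_mem_minimalPrimes {f : R}
    (hd : Dense ((π ⁻¹ᵁ specBasicOpen f : Z.Opens) : Set Z)) (z : Z)
    {P : Ideal (Z.presheaf.stalk z)} (hP : P ∈ minimalPrimes (Z.presheaf.stalk z)) :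
    toStalkMap π z f ∉ P := by
  intro hmem
  -- The union of the minimal primes is the set of zero divisors modulo the nilradical.
  have h' : toStalkMap π z f ∈ {x | ∃ y ∉ (⊥ : Ideal (Z.presheaf.stalk z)).radical,
      x * y ∈ (⊥ : Ideal (Z.presheaf.stalk z)).radical} := by
    rw [← Ideal.iUnion_minimalPrimes]
    exact Set.mem_iUnion₂.mpr ⟨P, hP, hmem⟩
  obtain ⟨y, hy, n, hn⟩ := h'
  obtain ⟨U, hzU, y, rfl⟩ := Z.presheaf.exists_germ_eq y
  have h0 : Z.presheaf.germ U z hzU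
      ((Z.presheaf.map (homOfLE le_top).op (globalSectionsMap π f) * y) ^ n) =
      Z.presheaf.germ U z hzU 0 := by
    rw [map_pow, map_mul, TopCat.Presheaf.germ_res_apply, map_zero]
    exact hn
  obtain ⟨V, hzV, i, j, hV⟩ := Z.presheaf.germ_eq z hzU hzU _ _ h0
  obtain ⟨_, ⟨W, hW, rfl⟩, hzW, hWV⟩ := Z.isBasis_affineOpens.exists_subset_of_mem_open
    (show z ∈ (V : Set Z) from hzV) V.2
  have hWU : W ≤ U := le_trans hWV i.le
  set y' := Z.presheaf.map (homOfLE hWU).op y with hy'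
  have hne : Z.basicOpen y' ≠ ⊥ := by
    intro hb
    have hW' : IsAffineOpen W := hW
    obtain ⟨k, hk⟩ := (Scheme.isNilpotent_iff_basicOpen_eq_bot_of_isCompact hW'.isCompact y').mpr hb
    refine hy ⟨k, ?_⟩
    have h1 := congrArg (Z.presheaf.germ W z hzW) hk
    rw [map_pow, hy', TopCat.Presheaf.germ_res_apply, map_zero] at h1
    exact h1
  obtain ⟨w, hwy, hwf⟩ := hd.inter_open_nonempty _ (Z.basicOpen y').2
    ((TopologicalSpace.Opens.ne_bot_iff_nonempty _).mp hne)
  have hwW : w ∈ W := Z.basicOpen_le y' hwy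
  have h1 : IsUnit (Z.presheaf.germ W w hwW y') := (Z.mem_basicOpen y' w hwW).mp hwy
  have h2 : IsUnit (toStalkMap π w f) := (mem_preimage_specBasicOpen_iff π f w).mp hwf
  have hV' := congrArg (Z.presheaf.germ V w (hWV hwW)) hV
  rw [TopCat.Presheaf.germ_res_apply, TopCat.Presheaf.germ_res_apply, map_pow, map_mul,
    TopCat.Presheaf.germ_res_apply, map_zero] at hV'
  rw [hy', TopCat.Presheaf.germ_res_apply] at h1
  have h3 := ((h2.mul h1).pow n)
  have h4 : (toStalkMap π w f * Z.presheaf.germ U w (hWU hwW) y) ^ n = 0 := hV'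
  rw [h4] at h3
  exact not_isUnit_zero h3

variable [IsLocalRing R]

/-- For Q ⊆ P the contractions to R agree, since otherwise P would lie over 𝔪, which contains f. As
π is injective over D(f), the points of Z given by P and Q coincide. -/
theorem mem_minimalPrimes_of_toStalkMap_notMem (hdim : ringKrullDim R = 1) {f : R}
    (hf : f ∈ maximalIdeal R) [IsIso (π ∣_ specBasicOpen f)] (z : Z)
    (P : Ideal (Z.presheaf.stalk z)) (hP : P.IsPrime) (hfP : toStalkMap π z f ∉ P) :
    P ∈ minimalPrimes (Z.presheaf.stalk z) := by
  refine ⟨⟨hP, bot_le⟩, fun Q hQ hQP => ?_⟩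
  have hQ' := hQ.1
  let p : PrimeSpectrum (Z.presheaf.stalk z) := ⟨P, hP⟩
  let q : PrimeSpectrum (Z.presheaf.stalk z) := ⟨Q, hQ'⟩
  have hpq : PrimeSpectrum.comap (toStalkMap π z) q = PrimeSpectrum.comap (toStalkMap π z) p := by
    refine PrimeSpectrum.ext ?_
    rcases (Ideal.comap_mono (f := toStalkMap π z) hQP).eq_or_lt with h | h
    · exact h
    · exact absurd ((eq_maximalIdeal_of_lt hdim h).ge hf) hfP
  have hmem : ∀ r : PrimeSpectrum (Z.presheaf.stalk z), toStalkMap π z f ∉ r.asIdeal →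
      Z.fromSpecStalk z r ∈ π ⁻¹ᵁ specBasicOpen f := by
    intro r hr
    change π (Z.fromSpecStalk z r) ∈ specBasicOpen f
    have h1 : (PrimeSpectrum.comap (toStalkMap π z) r : Spec (CommRingCat.of R)) ∈
      specBasicOpen f := (specBasicOpen_eq f).ge hr
    exact (congrArg (· ∈ specBasicOpen f) (comp_fromSpecStalk_apply π z r)).mpr h1
  have h1 : Z.fromSpecStalk z q = Z.fromSpecStalk z p := by
    refine injOn_of_isIso_morphismRestrict π (specBasicOpen f) (hmem q fun h => hfP (hQP h))
      (hmem p hfP) ?_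
    exact (comp_fromSpecStalk_apply π z q).trans
      (hpq.trans (comp_fromSpecStalk_apply π z p).symm)
  have h2 : q = p := (Z.fromSpecStalk z).isEmbedding.injective h1
  exact (congrArg PrimeSpectrum.asIdeal h2).ge

theorem isDomain_and_isPrincipal_stalk (hdim : ringKrullDim R = 1) {f : R}
    (hf : f ∈ maximalIdeal R) [IsIso (π ∣_ specBasicOpen f)]
    (hd : Dense ((π ⁻¹ᵁ specBasicOpen f : Z.Opens) : Set Z)) (hreg : singularLocus Z = ∅) (z : Z) :
    IsDomain (Z.presheaf.stalk z) ∧ IsPrincipalIdealRing (Z.presheaf.stalk z) ∧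
      toStalkMap π z f ≠ 0 := by
  have hz : IsRegularLocalRing (Z.presheaf.stalk z) := by
    by_contra h
    have : z ∈ singularLocus Z := h
    rw [hreg] at this
    exact this
  have h1 : ∀ P ∈ minimalPrimes (Z.presheaf.stalk z), toStalkMap π z f ∉ P :=
    fun P hP => toStalkMap_notMem_of_mem_minimalPrimes π hd z hP
  obtain ⟨hdom, hprin⟩ := IsRegularLocalRing.isDomain_and_isPrincipal_of_height_le_one
    (height_maximalIdeal_le_one h1 (mem_minimalPrimes_of_toStalkMap_notMem π hdim hf z))
  refine ⟨hdom, hprin, fun h0 => h1 ⊥ ⟨⟨Ideal.isPrime_bot, le_rfl⟩, fun _ _ _ => bot_le⟩ ?_⟩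
  rw [h0]
  exact zero_mem _

theorem exists_algEquiv_integralClosure [IsNoetherianRing R] (hdim : ringKrullDim R = 1) {f : R}
    (hf : f ∈ maximalIdeal R) (hf0 : f ∈ R⁰) [IsIso (π ∣_ specBasicOpen f)] [IsProper π]
    (hd : Dense ((π ⁻¹ᵁ specBasicOpen f : Z.Opens) : Set Z)) (hreg : singularLocus Z = ∅) :
    letI := (globalSectionsMap π).toAlgebra
    Nonempty (Γ(Z, ⊤) ≃ₐ[R] integralClosure R (FractionRing R)) := by
  let := (globalSectionsMap π).toAlgebra
  let := (basicOpenSectionsMap π f).toAlgebra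
  have hE : IsLocalization.Away f Γ(Z, π ⁻¹ᵁ specBasicOpen f) :=
    isLocalization_away_basicOpenSections π f
  have hK := isLocalization_away_fractionRing hdim hf hf0 (FractionRing R)
  let θ : Γ(Z, π ⁻¹ᵁ specBasicOpen f) ≃ₐ[R] FractionRing R :=
    IsLocalization.algEquiv (Submonoid.powers f) _ _
  let res : Γ(Z, ⊤) →ₐ[R] Γ(Z, π ⁻¹ᵁ specBasicOpen f) :=
    { (Z.presheaf.map (homOfLE (le_top : π ⁻¹ᵁ specBasicOpen f ≤ ⊤)).op).hom with
      commutes' := fun r => rfl }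
  have hst := isDomain_and_isPrincipal_stalk π hdim hf hd hreg
  have hdom : ∀ z, IsDomain (Z.presheaf.stalk z) := fun z => (hst z).1
  -- Regular stalks make Z reduced, so a nonzero section is invertible somewhere on the dense open
  -- set.
  have hres : Function.Injective res := by
    have : IsReduced Z := isReduced_of_isReduced_stalk Z
    refine (injective_iff_map_eq_zero res).mpr fun a ha => ?_
    rw [← basicOpen_eq_bot_iff]
    by_contra hne
    obtain ⟨w, hwa, hwf⟩ := hd.inter_open_nonempty _ (Z.basicOpen a).2
      ((TopologicalSpace.Opens.ne_bot_iff_nonempty _).mp hne)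
    have h1 : IsUnit (Z.presheaf.germ ⊤ w trivial a) := (Z.mem_basicOpen a w trivial).mp hwa
    have h2 := congrArg (Z.presheaf.germ _ w hwf) ha
    have h3 : Z.presheaf.germ _ w hwf (Z.presheaf.map (homOfLE
      (le_top : π ⁻¹ᵁ specBasicOpen f ≤ ⊤)).op a) = Z.presheaf.germ _ w hwf 0 := h2
    rw [TopCat.Presheaf.germ_res_apply, map_zero] at h3
    rw [h3] at h1
    exact not_isUnit_zero h1
  have hint : ∀ a : Γ(Z, ⊤), IsIntegral R a := by
    intro a
    have h1 := isIntegral_appTop_of_universallyClosed π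
    have h2 : (globalSectionsMap π).IsIntegral := by
      have := RingHom.IsIntegral.trans (Scheme.ΓSpecIso (CommRingCat.of R)).inv.hom π.appTop.hom
        (RingHom.isIntegral_of_surjective _
          (ConcreteCategory.bijective_of_isIso (Scheme.ΓSpecIso (CommRingCat.of R)).inv).2) h1
      exact this
    exact h2 a
  -- Write e = r/fⁿ. In the fraction field of each stalk it is integral over the stalk, which is
  -- integrally closed, so fⁿ divides r there and hence globally.
  have hsurj : ∀ e : Γ(Z, π ⁻¹ᵁ specBasicOpen f), IsIntegral R e → ∃ a, res a = e := by
    intro e he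
    obtain ⟨⟨r, _, n, rfl⟩, hr⟩ := IsLocalization.surj (M := Submonoid.powers f) e
    simp only [map_pow] at hr
    have hdvd : globalSectionsMap π f ^ n ∣ globalSectionsMap π r := by
      refine dvd_of_germ_dvd (fun z => ?_) fun z => ?_
      · rw [map_pow]
        exact pow_ne_zero n (hst z).2.2
      · have := (hst z).2.1
        let B := Z.presheaf.stalk z
        let σ : R →+* FractionRing B := (algebraMap B (FractionRing B)).comp (toStalkMap π z)
        have hσ : IsUnit (σ f) := by
          refine IsUnit.mk0 _ fun h => (hst z).2.2 ?_
          exact (map_eq_zero_iff _ (IsFractionRing.injective B (FractionRing B))).mp h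
        let ψ : Γ(Z, π ⁻¹ᵁ specBasicOpen f) →+* FractionRing B := IsLocalization.Away.lift f hσ
        have hψ : ∀ x, ψ (algebraMap R _ x) = σ x := fun x => IsLocalization.Away.lift_eq f hσ x
        have hψe : IsIntegral B (ψ e) := by
          obtain ⟨q, hq, hq0⟩ := he
          refine ⟨q.map (toStalkMap π z), hq.map _, ?_⟩
          have h1 := congrArg ψ hq0
          rw [map_zero, Polynomial.hom_eval₂] at h1
          rw [Polynomial.eval₂_map]
          have h2 : (algebraMap B (FractionRing B)).comp (toStalkMap π z) =
            ψ.comp (algebraMap R _) := RingHom.ext fun x => (hψ x).symm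
          rw [h2]
          exact h1
        obtain ⟨b, hb⟩ := IsIntegrallyClosed.isIntegral_iff.mp hψe
        refine ⟨b, ?_⟩
        have h1 := congrArg ψ hr
        rw [map_mul, map_pow, hψ, hψ, ← hb] at h1
        rw [map_pow]
        refine IsFractionRing.injective B (FractionRing B) ?_
        rw [map_mul, map_pow, mul_comm]
        exact h1.symm
    obtain ⟨a, ha⟩ := hdvd
    refine ⟨a, ?_⟩
    have hu : IsUnit (algebraMap R Γ(Z, π ⁻¹ᵁ specBasicOpen f) f) :=
      IsLocalization.Away.algebraMap_isUnit f
    have h1 : res (algebraMap R _ r) = res (algebraMap R _ f ^ n * a) := congrArg res ha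
    rw [map_mul, map_pow, res.commutes, res.commutes, ← hr, mul_comm] at h1
    exact ((hu.pow n).mul_left_cancel h1).symm
  let F : Γ(Z, ⊤) →ₐ[R] integralClosure R (FractionRing R) :=
    ((θ : _ →ₐ[R] FractionRing R).comp res).codRestrict _ fun a => (hint a).map _
  refine ⟨AlgEquiv.ofBijective F ⟨fun a b h => ?_, fun x => ?_⟩⟩
  · exact hres (θ.injective (congrArg Subtype.val h))
  · obtain ⟨a, ha⟩ := hsurj (θ.symm x) (x.2.map θ.symm)
    refine ⟨a, Subtype.ext ?_⟩
    change θ (res a) = x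
    rw [ha, AlgEquiv.apply_symm_apply]

theorem length_quotient_range_eq_of_algEquiv {R A B : Type*} [CommRing R] [CommRing A] [CommRing B]
    [Algebra R A] [Algebra R B] (e : A ≃ₐ[R] B) :
    Module.length R (A ⧸ LinearMap.range (Algebra.linearMap R A)) =
      Module.length R (B ⧸ LinearMap.range (Algebra.linearMap R B)) := by
  refine (Submodule.Quotient.equiv _ _ e.toLinearEquiv ?_).length_eq
  rw [← LinearMap.range_comp]
  congr 1
  ext
  simp

theorem genusOf_eq_singularityOrder [IsNoetherianRing R] [_root_.IsReduced R]
    (hdim : ringKrullDim R = 1) (h : IsResolution π) : genusOf π = singularityOrder R := by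
  let := (globalSectionsMap π).toAlgebra
  suffices h : Nonempty (Γ(Z, ⊤) ≃ₐ[R] integralClosure R (FractionRing R)) from
    length_quotient_range_eq_of_algEquiv h.some
  obtain ⟨U, hU, hd, hi⟩ := h.iso_off_sing
  by_cases hreg : IsRegularLocalRing R
  · have hUtop : U = ⊤ := by
      refine TopologicalSpace.Opens.ext (hU.trans ?_)
      rw [singularLocus_Spec_of_isRegularLocalRing hdim hreg]
      simp
    subst hUtop
    have h1 := isIso_app_of_isIso_morphismRestrict π ⊤
    have h2 : Function.Bijective (algebraMap R Γ(Z, ⊤)) := by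
      have : Function.Bijective ((Scheme.ΓSpecIso (CommRingCat.of R)).inv ≫ π.app ⊤) :=
        ConcreteCategory.bijective_of_isIso _
      exact this
    exact ⟨(AlgEquiv.ofBijective (Algebra.ofId R Γ(Z, ⊤)) h2).symm.trans
      (AlgEquiv.ofBijective (Algebra.ofId R _) (bijective_algebraMap_integralClosure hdim hreg))⟩
  · obtain ⟨f, hf, hf0⟩ := exists_mem_maximalIdeal_nonZeroDivisors hdim
    have hUf : U = specBasicOpen f := by
      refine TopologicalSpace.Opens.ext (hU.trans ?_)
      rw [singularLocus_Spec_of_not_isRegularLocalRing hdim hreg, specBasicOpen_eq]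
      exact (basicOpen_eq_compl_closedPoint hdim hf hf0).symm
    subst hUf
    have := h.proper
    exact exists_algEquiv_integralClosure π hdim hf hf0 hd h.nonsingular

end Resolution

/-! ### Homogeneous elements with no positive-degree annihilator -/

section GradedNonzerodivisor

/-- In a reduced Noetherian ring with a multiplicative family of additively closed subsets, there is an
element of positive degree annihilating no nonzero element of positive degree. -/
theorem exists_forall_mul_eq_zero_imp {A : Type*} [CommRing A] [IsNoetherianRing A]
    [_root_.IsReduced A] (H : ℕ → Set A) (h0 : ∀ i, 0 ∈ H i)
    (hadd : ∀ i, ∀ a ∈ H i, ∀ b ∈ H i, a + b ∈ H i)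
    (hH : ∀ i j, ∀ a ∈ H i, ∀ b ∈ H j, a * b ∈ H (i + j)) :
    ∃ d, 0 < d ∧ ∃ x ∈ H d, ∀ e, 0 < e → ∀ y ∈ H e, x * y = 0 → y = 0 := by
  have hpow : ∀ d, ∀ x ∈ H d, ∀ k, 0 < k → x ^ k ∈ H (d * k) := by
    intro d x hx k hk
    induction k, hk using Nat.le_induction with
    | base => simpa using hx
    | succ k _ ih => rw [pow_succ, Nat.mul_succ]; exact hH _ _ _ ih _ hx
  -- A maximal double annihilator corresponds to a homogeneous x with minimal annihilator.
  let S : Set (Ideal A) := {J | ∃ d, 0 < d ∧ ∃ x ∈ H d,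
    J = (Ideal.span {x}).annihilator.annihilator}
  obtain ⟨J, ⟨d, hd, x, hx, rfl⟩, hmax⟩ := set_has_maximal_iff_noetherian.mpr
    (inferInstanceAs (IsNoetherian A A)) S ⟨_, 1, one_pos, 0, h0 1, rfl⟩
  refine ⟨d, hd, x, hx, fun e he y hy hxy => ?_⟩
  have hmemann : ∀ z w : A, w ∈ (Ideal.span {z}).annihilator ↔ w * z = 0 := fun z w => by
    rw [Submodule.mem_annihilator_span_singleton, smul_eq_mul]
  -- When xy = 0, the powers bring x and y into the common degree de, and whatever kills the sum
  -- kills x by reducedness.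
  have hle : (Ideal.span {x ^ e + y ^ d}).annihilator ≤ (Ideal.span {x}).annihilator := by
    intro z hz
    rw [hmemann] at hz ⊢
    have h1 : (z * x) ^ (e + 1) = 0 := by
      obtain ⟨d', rfl⟩ := Nat.exists_eq_succ_of_ne_zero hd.ne'
      calc (z * x) ^ (e + 1) = z ^ e * x * (z * (x ^ e + y ^ (d' + 1)))
          - z ^ (e + 1) * y ^ d' * (x * y) := by ring
        _ = 0 := by rw [hz, hxy]; ring
    exact pow_eq_zero_iff (Nat.succ_ne_zero e) |>.mp h1
  have hJ := Submodule.annihilator_mono hle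
  have hmem : (Ideal.span {x ^ e + y ^ d}).annihilator.annihilator ∈ S :=
    ⟨d * e, Nat.mul_pos hd he, _, hadd _ _ (hpow _ _ hx _ he) _
      (mul_comm e d ▸ hpow _ _ hy _ hd), rfl⟩
  have heq := eq_of_le_of_not_lt hJ (hmax _ hmem)
  -- By maximality the sum kills everything that x kills, in particular y. Since x^e y = 0, this
  -- leaves y^(d+1) = 0.
  have h1 : x ^ e + y ^ d ∈ (Ideal.span {x}).annihilator.annihilator := by
    rw [heq, Submodule.mem_annihilator]
    intro z hz
    rw [hmemann] at hz
    rw [smul_eq_mul, mul_comm, hz]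
  have h2 := Submodule.mem_annihilator.mp h1 y ((hmemann _ _).mpr (by rw [mul_comm, hxy]))
  have h3 : y ^ (d + 1) = 0 := by
    obtain ⟨e', rfl⟩ := Nat.exists_eq_succ_of_ne_zero he.ne'
    calc y ^ (d + 1) = (x ^ (e' + 1) + y ^ d) • y - x ^ e' * (x * y) := by
          rw [smul_eq_mul]; ring
      _ = 0 := by rw [h2, hxy]; ring
  exact pow_eq_zero_iff (Nat.succ_ne_zero d) |>.mp h3

end GradedNonzerodivisor

/-! ### The fiber cone modulo nilpotents -/

section FiberCone

variable {R : Type*} [CommRing R] (I : Ideal R)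

/-- The inclusion of `I ^ n` in degree `n` of the Rees algebra. -/
noncomputable def reesMonomial (n : ℕ) : ↥(I ^ n) →ₗ[R] reesAlgebra I :=
  LinearMap.codRestrict (Subalgebra.toSubmodule (reesAlgebra I))
    ((monomial n : R →ₗ[R] R[X]).comp (I ^ n).subtype) fun a => reesAlgebra.monomial_mem.mpr a.2

theorem reesMonomial_coe (n : ℕ) (a : ↥(I ^ n)) : (reesMonomial I n a : R[X]) = monomial n (a : R) :=
  rfl

theorem reesMonomial_mul (i j : ℕ) (a : ↥(I ^ i)) (b : ↥(I ^ j)) :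
    reesMonomial I i a * reesMonomial I j b =
      reesMonomial I (i + j) ⟨a * b, pow_add I i j ▸ Ideal.mul_mem_mul a.2 b.2⟩ :=
  Subtype.ext (monomial_mul_monomial i j _ _)

/-- The elements of `I ^ n` whose class in the fiber cone of `I` at `J` is nilpotent. -/
noncomputable def fiberNilpotents (J : Ideal R) (n : ℕ) : Ideal R :=
  ((((J.map (algebraMap R (reesAlgebra I))).radical.restrictScalars R).comap
    (reesMonomial I n)).map (I ^ n).subtype)

variable {I} {J : Ideal R}

theorem mem_fiberNilpotents {n : ℕ} {a : R} : a ∈ fiberNilpotents I J n ↔ ∃ h : a ∈ I ^ n,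
    reesMonomial I n ⟨a, h⟩ ∈ (J.map (algebraMap R (reesAlgebra I))).radical := by
  constructor
  · rintro ⟨⟨b, hb⟩, h, rfl⟩
    exact ⟨hb, h⟩
  · rintro ⟨h, h'⟩
    exact ⟨⟨a, h⟩, h', rfl⟩

theorem fiberNilpotents_le (n : ℕ) : fiberNilpotents I J n ≤ I ^ n := fun _ h =>
  (mem_fiberNilpotents.mp h).1

theorem coeff_mem_of_mem_map {g : reesAlgebra I} (hg : g ∈ J.map (algebraMap R (reesAlgebra I)))
    (n : ℕ) : (g : R[X]).coeff n ∈ J * I ^ n := by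
  induction hg using Submodule.span_induction generalizing n with
  | mem x hx =>
    obtain ⟨r, hr, rfl⟩ := hx
    rw [show ((algebraMap R (reesAlgebra I) r : reesAlgebra I) : R[X]) = C r from rfl, coeff_C]
    split_ifs with h
    · subst h; simpa using hr
    · exact zero_mem _
  | zero => simp
  | add x y _ _ hx hy =>
    rw [Subalgebra.coe_add, coeff_add]
    exact add_mem (hx n) (hy n)
  | smul a x _ hx =>
    rw [smul_eq_mul, Subalgebra.coe_mul, coeff_mul]
    refine sum_mem fun p hp => ?_
    rw [← Finset.HasAntidiagonal.mem_antidiagonal.mp hp, pow_add, mul_left_comm]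
    exact Ideal.mul_mem_mul (a.2 p.1) (hx p.2)

theorem mul_pow_le_fiberNilpotents (n : ℕ) : J * I ^ n ≤ fiberNilpotents I J n := by
  refine Ideal.mul_le.mpr fun r hr a ha => mem_fiberNilpotents.mpr ⟨Ideal.mul_mem_left _ _ ha, ?_⟩
  refine Ideal.le_radical ?_
  have : reesMonomial I n ⟨r * a, Ideal.mul_mem_left _ _ ha⟩ =
      algebraMap R (reesAlgebra I) r * reesMonomial I n ⟨a, ha⟩ := by
    rw [← Algebra.smul_def, ← map_smul]
    rfl
  rw [this]
  exact Ideal.mul_mem_right _ _ (Ideal.mem_map_of_mem _ hr)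

/-- In the Noetherian Rees algebra a power of the radical of the extended ideal lies in that ideal;
the claim is its part in degree Mk. -/
theorem exists_fiberNilpotents_pow_le [IsNoetherianRing R] (M : ℕ) :
    ∃ k, 0 < k ∧ fiberNilpotents I J M ^ k ≤ J * I ^ (M * k) := by
  obtain ⟨k, hk⟩ := Ideal.exists_radical_pow_le_of_fg (J.map (algebraMap R (reesAlgebra I)))
    (Ideal.fg_of_isNoetherianRing _)
  have key : ∀ j, fiberNilpotents I J M ^ j ≤ (((((J.map (algebraMap R
      (reesAlgebra I))).radical ^ j).restrictScalars R).comap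
      (reesMonomial I (M * j))).map (I ^ (M * j)).subtype) := by
    intro j
    induction j with
    | zero =>
      intro a _
      exact ⟨⟨a, by simp⟩, by simp, rfl⟩
    | succ j ih =>
      rw [pow_succ]
      refine Ideal.mul_le.mpr fun a ha b hb => ?_
      obtain ⟨⟨a, ha'⟩, hn, rfl⟩ := ih ha
      obtain ⟨hb', hb⟩ := mem_fiberNilpotents.mp hb
      refine ⟨⟨a * b, by rw [Nat.mul_succ, pow_add]; exact Ideal.mul_mem_mul ha' hb'⟩, ?_, rfl⟩
      have := Ideal.mul_mem_mul hn hb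
      rw [reesMonomial_mul, ← pow_succ] at this
      exact this
  refine ⟨k + 1, k.succ_pos, fun a ha => ?_⟩
  obtain ⟨⟨a, ha'⟩, hn, rfl⟩ := key (k + 1) ha
  have h1 := coeff_mem_of_mem_map (hk (Ideal.pow_le_pow_right k.le_succ hn)) (M * (k + 1))
  rw [reesMonomial_coe, coeff_monomial, if_pos rfl] at h1
  exact h1

/-- This is the graded statement above for the Rees algebra modulo the radical of the extension of
J. -/
theorem exists_forall_mul_mem_fiberNilpotents [IsNoetherianRing R] (I J : Ideal R) :
    ∃ d, 0 < d ∧ ∃ x ∈ I ^ d, ∀ e, 0 < e → ∀ y ∈ I ^ e,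
      x * y ∈ fiberNilpotents I J (d + e) → y ∈ fiberNilpotents I J e := by
  set N := (J.map (algebraMap R (reesAlgebra I))).radical with hN
  have hred : _root_.IsReduced (reesAlgebra I ⧸ N) :=
    (Ideal.isRadical_iff_quotient_reduced N).mp (Ideal.radical_isRadical _)
  let H : ℕ → Set (reesAlgebra I ⧸ N) := fun n =>
    Set.range fun a => Ideal.Quotient.mk N (reesMonomial I n a)
  have h0 : ∀ i, 0 ∈ H i := fun i => ⟨0, by simp only [map_zero]⟩
  have hadd : ∀ i, ∀ a ∈ H i, ∀ b ∈ H i, a + b ∈ H i := by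
    rintro i _ ⟨a, rfl⟩ _ ⟨b, rfl⟩
    exact ⟨a + b, by simp only [map_add]⟩
  have hH : ∀ i j, ∀ a ∈ H i, ∀ b ∈ H j, a * b ∈ H (i + j) := by
    rintro i j _ ⟨a, rfl⟩ _ ⟨b, rfl⟩
    refine ⟨⟨a * b, pow_add I i j ▸ Ideal.mul_mem_mul a.2 b.2⟩, ?_⟩
    rw [← map_mul]
    exact congrArg _ (reesMonomial_mul I i j a b).symm
  obtain ⟨d, hd, _, ⟨⟨x, hx⟩, rfl⟩, h⟩ := exists_forall_mul_eq_zero_imp H h0 hadd hH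
  refine ⟨d, hd, x, hx, fun e he y hy hxy => ?_⟩
  have h1 := h e he (Ideal.Quotient.mk N (reesMonomial I e ⟨y, hy⟩)) ⟨⟨y, hy⟩, rfl⟩ (by
    change Ideal.Quotient.mk N _ * Ideal.Quotient.mk N _ = 0
    rw [← map_mul]
    exact Ideal.Quotient.eq_zero_iff_mem.mpr ((reesMonomial_mul I d e ⟨x, hx⟩ ⟨y, hy⟩).symm ▸
      (mem_fiberNilpotents.mp hxy).2))
  exact mem_fiberNilpotents.mpr ⟨hy, Ideal.Quotient.eq_zero_iff_mem.mp h1⟩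

end FiberCone

/-! ### Principal reductions of powers -/

section Reduction

variable {R : Type u} [CommRing R]

/-- Compute the length of R/fJ through J and through (f). Since (f)/fJ ≅ R/J has finite length, that
length cancels. -/
theorem relLength_span_mul_self {f : R} (hf0 : f ∈ R⁰) {J : Ideal R}
    (hJ : Module.length R (R ⧸ J) ≠ ⊤) :
    relLength (Ideal.span {f} * J) J = Module.length R (R ⧸ Ideal.span {f}) := by
  have hinj : Function.Injective (LinearMap.mulLeft R f) := fun a b h =>
    (mul_cancel_left_mem_nonZeroDivisors hf0).mp h
  have hmap : ∀ L : Ideal R, Ideal.span {f} * L = Submodule.map (LinearMap.mulLeft R f) L := by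
    intro L
    ext x
    rw [Ideal.mem_span_singleton_mul]
    rfl
  have h1 := relLength_add (R := R) (N := Ideal.span {f} * J) (M := J) (L := ⊤)
    Ideal.mul_le_right le_top
  have h2 := relLength_add (R := R) (N := Ideal.span {f} * J) (M := Ideal.span {f}) (L := ⊤)
    Ideal.mul_le_left le_top
  have h3 : relLength (Ideal.span {f} * J) (Ideal.span {f}) = relLength J ⊤ := by
    rw [hmap J, ← relLength_map hinj J ⊤, ← hmap ⊤, Ideal.mul_top]
  rw [h1, h3, relLength_top, relLength_top, add_comm] at h2
  exact ENat.add_right_injective_of_ne_top hJ h2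

theorem relLength_mono_left {V : Type*} [AddCommGroup V] [Module R V] {N N' M : Submodule R V}
    (h : N ≤ N') (h' : N' ≤ M) : relLength N' M ≤ relLength N M := by
  rw [relLength_add h h']
  exact le_add_self

theorem Ideal.sup_pow_succ_le (A B : Ideal R) (k : ℕ) :
    (A ⊔ B) ^ (k + 1) ≤ A * (A ⊔ B) ^ k ⊔ B ^ (k + 1) := by
  induction k with
  | zero => simp
  | succ k ih =>
    calc (A ⊔ B) ^ (k + 1 + 1) = (A ⊔ B) * (A ⊔ B) ^ (k + 1) := pow_succ' _ _
      _ = A * (A ⊔ B) ^ (k + 1) ⊔ B * (A ⊔ B) ^ (k + 1) := Ideal.sup_mul _ _ _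
      _ ≤ A * (A ⊔ B) ^ (k + 1) ⊔ B * (A * (A ⊔ B) ^ k ⊔ B ^ (k + 1)) :=
        sup_le_sup_left (Ideal.mul_mono_right ih) _
      _ ≤ _ := by
        rw [Ideal.mul_sup, ← pow_succ']
        refine sup_le le_sup_left (sup_le (le_trans ?_ le_sup_left) le_sup_right)
        rw [mul_left_comm, pow_succ' (A ⊔ B)]
        exact Ideal.mul_mono_right (Ideal.mul_mono_left le_sup_right)

variable [IsLocalRing R] [IsNoetherianRing R]

/-- Multiplication by x injects Iⁿ/Pₙ into I^(n+d)/P_(n+d), where Pₙ is the nilpotent part. These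
lengths are bounded by length(R/f) because fIⁿ ⊆ Pₙ. Where the length is maximal, the injection is
onto. -/
theorem exists_pow_add_le_sup_fiberNilpotents {f : R} (hf : f ∈ maximalIdeal R) (hf0 : f ∈ R⁰)
    (hfin : Module.length R (R ⧸ Ideal.span {f}) ≠ ⊤) {I : Ideal R}
    (hI : I.radical = maximalIdeal R) :
    ∃ d, 0 < d ∧ ∃ x ∈ I ^ d, ∃ n, I ^ (n + d) ≤
      Ideal.span {x} * I ^ n ⊔ fiberNilpotents I (maximalIdeal R) (n + d) := by
  obtain ⟨d, hd, x, hx, hxinj⟩ := exists_forall_mul_mem_fiberNilpotents I (maximalIdeal R)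
  let P := fiberNilpotents I (maximalIdeal R)
  have hb : ∀ n, 0 < n → relLength (P n) (I ^ n) ≤ Module.length R (R ⧸ Ideal.span {f}) := by
    intro n hn
    have hlen : Module.length R (R ⧸ I ^ n) ≠ ⊤ := by
      refine length_ne_top_of_smul_eq_zero (J := I ^ n) ?_ fun r hr y => ?_
      · rw [Ideal.radical_pow I hn.ne', hI]
      · obtain ⟨y, rfl⟩ := Ideal.Quotient.mk_surjective y
        rw [← Ideal.Quotient.mk_eq_mk, ← Submodule.Quotient.mk_smul,
          Submodule.Quotient.mk_eq_zero]
        exact Ideal.mul_mem_right _ _ hr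
    rw [← relLength_span_mul_self hf0 hlen]
    refine relLength_mono_left ?_ (fiberNilpotents_le n)
    refine le_trans (Ideal.mul_mono_left ?_) (mul_pow_le_fiberNilpotents n)
    rwa [Ideal.span_singleton_le_iff_mem]
  obtain ⟨n, hn, hmax⟩ : ∃ n, 0 < n ∧ ∀ k, 0 < k → relLength (P k) (I ^ k) ≤
      relLength (P n) (I ^ n) := by
    let c := (Module.length R (R ⧸ Ideal.span {f})).toNat
    have hb' : ∀ n, 0 < n → (relLength (P n) (I ^ n)).toNat ≤ c := fun n hn =>
      ENat.toNat_le_toNat (hb n hn) hfin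
    let S : Set ℕ := (fun n => (relLength (P n) (I ^ n)).toNat) '' {n | 0 < n}
    have hS : BddAbove S := ⟨c, by rintro _ ⟨n, hn, rfl⟩; exact hb' n hn⟩
    obtain ⟨n, hn, hnS⟩ := Nat.sSup_mem (s := S) ⟨_, 1, Nat.one_pos, rfl⟩ hS
    refine ⟨n, hn, fun k hk => ?_⟩
    have h1 := le_csSup hS ⟨k, hk, rfl⟩
    rw [← hnS] at h1
    rw [← ENat.natCast_le_natCast, ENat.natCast_toNat (ne_top_of_le_ne_top hfin (hb k hk)),
      ENat.natCast_toNat (ne_top_of_le_ne_top hfin (hb n hn))] at h1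
    exact h1
  refine ⟨d, hd, x, hx, n, ?_⟩
  let g : ↥(I ^ n) →ₗ[R] ↥(I ^ (n + d)) :=
    (LinearMap.mulLeft R x).restrict fun y hy => by
      rw [add_comm, pow_add]; exact Ideal.mul_mem_mul hx hy
  have hg : (P n).submoduleOf (I ^ n) = ((P (n + d)).submoduleOf (I ^ (n + d))).comap g := by
    ext ⟨y, hy⟩
    change y ∈ P n ↔ x * y ∈ P (n + d)
    constructor
    · intro h
      obtain ⟨h1, h2⟩ := mem_fiberNilpotents.mp h
      have := Ideal.mul_mem_left _ (reesMonomial I d ⟨x, hx⟩) h2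
      rw [reesMonomial_mul] at this
      rw [add_comm]
      exact mem_fiberNilpotents.mpr ⟨_, this⟩
    · intro h
      rw [add_comm] at h
      exact hxinj n hn y hy h
  let G := Submodule.mapQ _ _ g hg.le
  have hG : Function.Injective G := by
    rw [← LinearMap.ker_eq_bot, Submodule.ker_mapQ, ← hg, Submodule.mkQ_map_self]
  have h1 := Module.length_eq_add_of_exact G (LinearMap.range G).mkQ hG
    (Submodule.mkQ_surjective _) (LinearMap.exact_map_mkQ_range G)
  have h2 : Module.length R (_ ⧸ LinearMap.range G) = 0 := by
    have h3 := hmax (n + d) (by omega)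
    have h4 := ne_top_of_le_ne_top hfin (hb n hn)
    have h5 : relLength (P (n + d)) (I ^ (n + d)) = relLength (P n) (I ^ n) +
      Module.length R (_ ⧸ LinearMap.range G) := h1
    rw [h5] at h3
    have h6 := (ENat.add_le_add_iff_left h4).mp (h3.trans_eq (add_zero _).symm)
    exact le_antisymm h6 bot_le
  have hsurj : LinearMap.range G = ⊤ := by
    rw [Module.length_eq_zero_iff, Submodule.Quotient.subsingleton_iff] at h2
    exact h2
  intro a ha
  obtain ⟨b, hb⟩ := LinearMap.range_eq_top.mp hsurj (Submodule.Quotient.mk ⟨a, ha⟩)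
  obtain ⟨b, rfl⟩ := Submodule.mkQ_surjective _ b
  have h3 : (x * (b : R)) - a ∈ P (n + d) := 
    (Submodule.Quotient.eq ((P (n + d)).submoduleOf (I ^ (n + d))) (x := g b) (y := ⟨a, ha⟩)).mp hb
  have h4 : a = x * b - (x * b - a) := by ring
  rw [h4]
  exact sub_mem (Ideal.mem_sup_left (Ideal.mul_mem_mul (Ideal.mem_span_singleton_self x) b.2))
    (Ideal.mem_sup_right h3)

/-- Some power of an ideal of definition has a principal reduction. -/
theorem exists_pow_add_eq_span_mul_pow {f : R} (hf : f ∈ maximalIdeal R) (hf0 : f ∈ R⁰)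
    (hfin : Module.length R (R ⧸ Ideal.span {f}) ≠ ⊤) {I : Ideal R}
    (hI : I.radical = maximalIdeal R) :
    ∃ d, 0 < d ∧ ∃ x ∈ I ^ d, ∃ m₀, ∀ m, m₀ ≤ m → I ^ (m + d) = Ideal.span {x} * I ^ m := by
  obtain ⟨d, hd, x, hx, n, hn⟩ := exists_pow_add_le_sup_fiberNilpotents hf hf0 hfin hI
  obtain ⟨k, hk, hle⟩ := exists_fiberNilpotents_pow_le (I := I) (J := maximalIdeal R) (n + d)
  obtain ⟨k, rfl⟩ := Nat.exists_eq_succ_of_ne_zero hk.ne'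
  have hsup : Ideal.span {x} * I ^ n ⊔ fiberNilpotents I (maximalIdeal R) (n + d) ≤
      I ^ (n + d) := by
    refine sup_le ?_ (fiberNilpotents_le _)
    rw [add_comm, pow_add]
    exact Ideal.mul_mono_left ((Ideal.span_singleton_le_iff_mem _).mpr hx)
  -- Chosen so that m₀ + d = (n + d)(k + 1): in the (k + 1)-st power of the inclusion the purely
  -- nilpotent term falls into 𝔪 I^(m₀+d), which Nakayama removes.
  set m₀ := n + (n + d) * k with hm₀
  have h1 : I ^ (m₀ + d) ≤ Ideal.span {x} * I ^ m₀ ⊔ maximalIdeal R * I ^ (m₀ + d) := by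
    have e : m₀ + d = (n + d) * (k + 1) := by rw [hm₀]; ring
    calc I ^ (m₀ + d) = (I ^ (n + d)) ^ (k + 1) := by rw [e, pow_mul]
      _ ≤ _ := Ideal.pow_right_mono hn (k + 1)
      _ ≤ _ := Ideal.sup_pow_succ_le _ _ k
      _ ≤ _ := by
        refine sup_le_sup ?_ (e ▸ hle)
        rw [mul_assoc, hm₀, pow_add I n, pow_mul]
        exact Ideal.mul_mono_right (Ideal.mul_mono_right (Ideal.pow_right_mono hsup k))
  have h2 : I ^ (m₀ + d) ≤ Ideal.span {x} * I ^ m₀ :=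
    Submodule.le_of_le_smul_of_le_jacobson_bot (I ^ (m₀ + d)).fg_of_isNoetherianRing
      (IsLocalRing.maximalIdeal_le_jacobson _) h1
  refine ⟨d, hd, x, hx, m₀, fun m hm => le_antisymm ?_ ?_⟩
  · obtain ⟨j, rfl⟩ := Nat.exists_eq_add_of_le hm
    rw [show m₀ + j + d = (m₀ + d) + j by ring, pow_add, pow_add I m₀ j, ← mul_assoc]
    exact Ideal.mul_mono_left h2
  · rw [add_comm, pow_add]
    exact Ideal.mul_mono_left ((Ideal.span_singleton_le_iff_mem _).mpr hx)

end Reduction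

/-! ### The blow-up algebra and the length of R/I^m -/

section BlowUpAlgebra

variable {R : Type u} [CommRing R] {I : Ideal R} {d : ℕ} {x : R}

/-- The algebra `⋃ k, x⁻ᵏ I ^ (d * k)` inside a ring in which `x ∈ I ^ d` is a unit. -/
def blowUpAlgebra (K : Type*) [CommRing K] [Algebra R K] (hx : x ∈ I ^ d) : Subalgebra R K where
  carrier := {z | ∃ k, ∃ r ∈ I ^ (d * k), algebraMap R K x ^ k * z = algebraMap R K r}
  mul_mem' := by
    rintro a b ⟨k, r, hr, h⟩ ⟨l, s, hs, h'⟩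
    refine ⟨k + l, r * s, ?_, ?_⟩
    · rw [mul_add, pow_add]
      exact Ideal.mul_mem_mul hr hs
    · rw [map_mul, ← h, ← h']
      ring
  add_mem' := by
    rintro a b ⟨k, r, hr, h⟩ ⟨l, s, hs, h'⟩
    have hxk : ∀ k, x ^ k ∈ I ^ (d * k) := fun k => pow_mul I d k ▸ Ideal.pow_mem_pow hx k
    refine ⟨k + l, x ^ l * r + x ^ k * s, ?_, ?_⟩
    · rw [mul_add, pow_add]
      exact add_mem (mul_comm r _ ▸ Ideal.mul_mem_mul hr (hxk l)) (Ideal.mul_mem_mul (hxk k) hs)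
    · rw [map_add, map_mul, map_mul, ← h, ← h', map_pow, map_pow]
      ring
  algebraMap_mem' r := ⟨0, r, by simp, by simp⟩

variable {K : Type*} [CommRing K] [Algebra R K]

variable {m₀ : ℕ}

theorem pow_add_mul_eq_span_pow_mul (hred : ∀ m, m₀ ≤ m → I ^ (m + d) = Ideal.span {x} * I ^ m)
    {m : ℕ} (hm : m₀ ≤ m) (k : ℕ) :
    I ^ (m + d * k) = Ideal.span {x ^ k} * I ^ m := by
  induction k with
  | zero => simp
  | succ k ih =>
    rw [Nat.mul_succ, ← add_assoc, hred _ (by omega), ih, ← mul_assoc,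
      Ideal.span_singleton_mul_span_singleton, ← pow_succ']

/-- For large m the ideal I^m is already stable under B, because I^m · I^(dk) = x^k I^m. Finiteness
of B and the equality I^m B = I^m both rest on this. -/
theorem exists_algebraMap_mul_eq (hred : ∀ m, m₀ ≤ m → I ^ (m + d) = Ideal.span {x} * I ^ m)
    (hx : x ∈ I ^ d) (hxu : IsUnit (algebraMap R K x)) {m : ℕ} (hm : m₀ ≤ m) {a : R}
    (ha : a ∈ I ^ m) {z : K} (hz : z ∈ blowUpAlgebra K hx) :
    ∃ c ∈ I ^ m, algebraMap R K a * z = algebraMap R K c := by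
  obtain ⟨k, r, hr, h⟩ := hz
  have h1 : a * r ∈ I ^ (m + d * k) := by rw [pow_add]; exact Ideal.mul_mem_mul ha hr
  rw [pow_add_mul_eq_span_pow_mul hred hm] at h1
  obtain ⟨c, hc, hc'⟩ := Ideal.mem_span_singleton_mul.mp h1
  refine ⟨c, hc, (hxu.pow k).mul_left_cancel ?_⟩
  rw [mul_left_comm, h, ← map_mul, ← hc', map_mul, map_pow]

/-- Multiplication by the unit x^m₀ embeds B into the image of R, which is Noetherian. -/
theorem finite_blowUpAlgebra (hred : ∀ m, m₀ ≤ m → I ^ (m + d) = Ideal.span {x} * I ^ m)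
    [IsNoetherianRing R] (hx : x ∈ I ^ d) (hd : 0 < d)
    (hxu : IsUnit (algebraMap R K x)) : Module.Finite R (blowUpAlgebra K hx) := by
  have hu := hxu.pow m₀
  have hinj : Function.Injective (LinearMap.mulLeft R (algebraMap R K x ^ m₀)) := fun a b h =>
    hu.mul_left_cancel h
  suffices (Subalgebra.toSubmodule (blowUpAlgebra K hx)).FG from Module.Finite.of_fg this
  refine Submodule.fg_of_fg_map_injective _ hinj ?_
  have hN : IsNoetherian R (LinearMap.range (Algebra.linearMap R K)) := inferInstance
  refine isNoetherian_submodule.mp hN _ ?_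
  rintro _ ⟨z, hz, rfl⟩
  have h1 : x ^ m₀ ∈ I ^ (d * m₀) := pow_mul I d m₀ ▸ Ideal.pow_mem_pow hx m₀
  obtain ⟨c, -, hc⟩ := exists_algebraMap_mul_eq hred hx hxu (Nat.le_mul_of_pos_left m₀ hd) h1 hz
  refine ⟨c, ?_⟩
  rw [map_pow] at hc
  exact hc.symm

theorem mem_map_pow_iff (hred : ∀ m, m₀ ≤ m → I ^ (m + d) = Ideal.span {x} * I ^ m)
    (hx : x ∈ I ^ d) (hxu : IsUnit (algebraMap R K x)) {m : ℕ} (hm : m₀ ≤ m)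
    (b : blowUpAlgebra K hx) : b ∈ I.map (algebraMap R (blowUpAlgebra K hx)) ^ m ↔
      ∃ c ∈ I ^ m, algebraMap R (blowUpAlgebra K hx) c = b := by
  rw [← Ideal.map_pow]
  constructor
  · intro hb
    induction hb using Submodule.span_induction with
    | mem y hy => exact hy
    | zero => exact ⟨0, zero_mem _, map_zero _⟩
    | add y z _ _ hy hz =>
      obtain ⟨a, ha, rfl⟩ := hy
      obtain ⟨b, hb, rfl⟩ := hz
      exact ⟨a + b, add_mem ha hb, map_add _ _ _⟩
    | smul z y _ hy =>
      obtain ⟨a, ha, rfl⟩ := hy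
      obtain ⟨c, hc, h⟩ := exists_algebraMap_mul_eq hred hx hxu hm ha z.2
      refine ⟨c, hc, Subtype.ext ?_⟩
      rw [smul_eq_mul, mul_comm]
      exact h.symm
  · rintro ⟨c, hc, rfl⟩
    exact Ideal.mem_map_of_mem _ hc

theorem map_pow_eq_span (hx : x ∈ I ^ d) (hxu : IsUnit (algebraMap R K x)) :
    I.map (algebraMap R (blowUpAlgebra K hx)) ^ d =
      Ideal.span {algebraMap R (blowUpAlgebra K hx) x} := by
  rw [← Ideal.map_pow]
  refine le_antisymm (Ideal.map_le_iff_le_comap.mpr fun a ha => ?_)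
    ((Ideal.span_singleton_le_iff_mem _).mpr (Ideal.mem_map_of_mem _ hx))
  obtain ⟨u, hu⟩ := hxu.exists_right_inv
  have hz : u * algebraMap R K a ∈ blowUpAlgebra K hx :=
    ⟨1, a, by simpa using ha, by rw [pow_one, ← mul_assoc, hu, one_mul]⟩
  refine Ideal.mem_span_singleton.mpr ⟨⟨_, hz⟩, Subtype.ext ?_⟩
  change algebraMap R K a = algebraMap R K x * (u * algebraMap R K a)
  rw [← mul_assoc, hu, one_mul]

/-- In a semilocal ring, an ideal with a power generated by a nonzerodivisor is principal. -/
theorem Ideal.isPrincipal_of_pow_eq_span {B : Type*} [CommRing B]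
    (hB : {P : Ideal B | P.IsMaximal}.Finite) {L : Ideal B} {d : ℕ} (hd : 0 < d) {x : B}
    (hx : x ∈ B⁰) (h : L ^ d = Ideal.span {x}) : ∃ y ∈ B⁰, L = Ideal.span {y} := by
  -- L is invertible because a power of it is, and an invertible ideal of a semilocal ring is
  -- principal.
  have hu : IsUnit (L : FractionalIdeal B⁰ (FractionRing B)) := by
    have h1 : IsUnit ((L : FractionalIdeal B⁰ (FractionRing B)) ^ d) := by
      rw [← FractionalIdeal.coeIdeal_pow, h, FractionalIdeal.coeIdeal_span_singleton]
      obtain ⟨u, hu⟩ := (IsLocalization.map_units (FractionRing B) (⟨x, hx⟩ : B⁰)).exists_right_inv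
      refine IsUnit.of_mul_eq_one (FractionalIdeal.spanSingleton B⁰ u) ?_
      rw [FractionalIdeal.spanSingleton_mul_spanSingleton, hu, FractionalIdeal.spanSingleton_one]
    exact (isUnit_pow_iff hd.ne').mp h1
  obtain ⟨y, hy⟩ := Ideal.IsPrincipal.of_finite_maximals_of_isUnit hB hu
  refine ⟨y, ?_, hy⟩
  have hy' : L = Ideal.span {y} := hy
  rw [hy', Ideal.span_singleton_pow] at h
  obtain ⟨c, hc⟩ := Ideal.mem_span_singleton.mp (h.ge (Ideal.mem_span_singleton_self x))
  rw [hc] at hx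
  rw [← Nat.succ_pred_eq_of_pos hd, pow_succ] at hx
  exact (mul_mem_nonZeroDivisors.mp (mul_mem_nonZeroDivisors.mp hx).1).2

theorem finite_setOf_isMaximal_of_finite [IsLocalRing R] (B : Type*) [CommRing B]
    [Algebra R B] [Module.Finite R B] : {P : Ideal B | P.IsMaximal}.Finite := by
  refine (Algebra.QuasiFinite.finite_primesOver (S := B) (maximalIdeal R)).subset fun P hP => ?_
  have : P.IsMaximal := hP
  refine ⟨inferInstance, ⟨?_⟩⟩
  exact (eq_maximalIdeal (Ideal.isMaximal_comap_of_isIntegral_of_isMaximal P)).symm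

theorem relLength_span_pow_top {B : Type*} [CommRing B] [Algebra R B] {y : B} (hy : y ∈ B⁰) (m : ℕ) :
    relLength ((Ideal.span {y ^ m}).restrictScalars R) ⊤ =
      m * relLength ((Ideal.span {y}).restrictScalars R) ⊤ := by
  have hmap : ∀ m (L : Ideal B), (Ideal.span {y ^ m} * L).restrictScalars R =
      (L.restrictScalars R).map (LinearMap.mulLeft R (y ^ m)) := by
    intro m L
    ext z
    rw [Submodule.restrictScalars_mem, Ideal.mem_span_singleton_mul]
    rfl
  induction m with
  | zero => simp [relLength_self]
  | succ m ih =>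
    have hinj : Function.Injective (LinearMap.mulLeft R (y ^ m)) := fun a b h =>
      (mul_cancel_left_mem_nonZeroDivisors (pow_mem hy m)).mp h
    have hle : (Ideal.span {y ^ (m + 1)}).restrictScalars R ≤
        (Ideal.span {y ^ m}).restrictScalars R := by
      intro z hz
      exact Ideal.span_singleton_le_span_singleton.mpr (pow_dvd_pow y m.le_succ) hz
    rw [relLength_add hle le_top, ih]
    have h1 := relLength_map hinj ((Ideal.span {y}).restrictScalars R)
      ((⊤ : Ideal B).restrictScalars R)
    rw [← hmap, ← hmap, Ideal.mul_top, Ideal.span_singleton_mul_span_singleton, ← pow_succ,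
      Submodule.restrictScalars_top] at h1
    rw [h1]
    push_cast
    ring

/-- Here b is the length of B/R and c that of B/yB, where IB = yB. For m ≥ m₀ the image of I^m is
y^m B, and the length of B/y^m B is counted once through R and once through the powers of y. -/
theorem length_quotient_pow_add_length_quotient_range (hred : ∀ m, m₀ ≤ m → I ^ (m + d) = Ideal.span {x} * I ^ m)
    [IsLocalRing R] [IsNoetherianRing R]
    (hI : I.radical = maximalIdeal R) (hx : x ∈ I ^ d) (hd : 0 < d)
    (hinj : Function.Injective (algebraMap R K)) (hxu : IsUnit (algebraMap R K x)) :
    ∃ b c : ℕ, Module.length R (blowUpAlgebra K hx ⧸ LinearMap.range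
        (Algebra.linearMap R (blowUpAlgebra K hx))) = b ∧
      ∀ m, m₀ ≤ m → Module.length R (R ⧸ I ^ m) + b = m * c := by
  let B := blowUpAlgebra K hx
  have hfin : Module.Finite R B := finite_blowUpAlgebra hred hx hd hxu
  have hxB : algebraMap R B x ∈ B⁰ :=
    mem_nonZeroDivisors_of_injective (f := B.val) Subtype.val_injective hxu.mem_nonZeroDivisors
  obtain ⟨y, hy, hL⟩ := Ideal.isPrincipal_of_pow_eq_span (finite_setOf_isMaximal_of_finite (R := R) B)
    hd hxB (map_pow_eq_span hx hxu)
  have hlinj : Function.Injective (Algebra.linearMap R B) := fun a b h =>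
    hinj (congrArg Subtype.val h)
  have hc : relLength ((Ideal.span {y}).restrictScalars R) ⊤ ≠ ⊤ := by
    rw [relLength_top]
    refine length_ne_top_of_smul_eq_zero (J := I) hI.ge fun r hr z => ?_
    obtain ⟨z, rfl⟩ := Submodule.mkQ_surjective _ z
    rw [← map_smul, Submodule.mkQ_apply, Submodule.Quotient.mk_eq_zero,
      Submodule.restrictScalars_mem, ← hL, Algebra.smul_def]
    exact Ideal.mul_mem_right _ _ (Ideal.mem_map_of_mem _ hr)
  have key : ∀ m, m₀ ≤ m → Module.length R (R ⧸ I ^ m) +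
      Module.length R (B ⧸ LinearMap.range (Algebra.linearMap R B)) =
      m * relLength ((Ideal.span {y}).restrictScalars R) ⊤ := by
    intro m hm
    have hmap : (Ideal.span {y ^ m}).restrictScalars R =
        Submodule.map (Algebra.linearMap R B) (I ^ m) := by
      ext b
      rw [Submodule.restrictScalars_mem, ← Ideal.span_singleton_pow, ← hL]
      exact mem_map_pow_iff hred hx hxu hm b
    rw [← relLength_span_pow_top hy, hmap, ← relLength_top, ← relLength_top,
      relLength_add (M := Submodule.map (Algebra.linearMap R B) ⊤) (Submodule.map_mono le_top)
        le_top, relLength_map hlinj, LinearMap.range_eq_map]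
  -- The identity at m = m₀ bounds the length of B/R by a finite number.
  have hb : Module.length R (B ⧸ LinearMap.range (Algebra.linearMap R B)) ≠ ⊤ := by
    intro h
    have := key m₀ le_rfl
    rw [h, add_top] at this
    exact (WithTop.mul_ne_top (ENat.natCast_ne_top _) hc) this.symm
  refine ⟨_, (relLength ((Ideal.span {y}).restrictScalars R) ⊤).toNat,
    (ENat.natCast_toNat hb).symm, fun m hm => ?_⟩
  rw [ENat.natCast_toNat hb, ENat.natCast_toNat hc, key m hm]

end BlowUpAlgebra

/-! ### Hilbert–Samuel coefficients in dimension one -/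

section HilbertSamuel

variable {R : Type u} [CommRing R] {I : Ideal R}

theorem isHilbertSamuelCoeffs_one_iff {e : Fin 2 → ℤ} : IsHilbertSamuelCoeffs 1 I e ↔
    ∀ᶠ n : ℕ in Filter.atTop, ∃ h : ℕ, Module.length R (R ⧸ I ^ (n + 1)) = (h : ℕ∞) ∧
      (h : ℤ) = (n + 1) * e 0 - e 1 := by
  refine Filter.eventually_congr (Filter.Eventually.of_forall fun n => ?_)
  refine exists_congr fun h => and_congr_right fun _ => ?_
  have h1 : ∑ i : Fin (1 + 1), (-1) ^ (i : ℕ) * e i * ((n + 1 - i).choose (1 - i) : ℤ) =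
      (n + 1) * e 0 - e 1 := by
    rw [Fin.sum_univ_two]
    simp
    ring
  rw [h1]

theorem IsHilbertSamuelCoeffs.eq_of_one {e e' : Fin 2 → ℤ} (h : IsHilbertSamuelCoeffs 1 I e)
    (h' : IsHilbertSamuelCoeffs 1 I e') : e = e' := by
  have key := (isHilbertSamuelCoeffs_one_iff.mp h).and (isHilbertSamuelCoeffs_one_iff.mp h')
  obtain ⟨N, hN⟩ := Filter.eventually_atTop.mp key
  have heq : ∀ n, N ≤ n → ((n : ℤ) + 1) * e 0 - e 1 = (n + 1) * e' 0 - e' 1 := by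
    intro n hn
    obtain ⟨⟨a, ha, ha'⟩, b, hb, hb'⟩ := hN n hn
    rw [← ha', ← hb']
    exact_mod_cast ha.symm.trans hb
  have h1 := heq N le_rfl
  have h2 := heq (N + 1) N.le_succ
  push_cast at h2
  have h0 : e 0 = e' 0 := by linarith
  have h3 : e 1 = e' 1 := by rw [h0] at h1; linarith
  ext i
  fin_cases i
  · exact h0
  · exact h3

theorem isHilbertSamuelCoeffs_of_length_add_eq {b c m₀ : ℕ}
    (h : ∀ m, m₀ ≤ m → Module.length R (R ⧸ I ^ m) + b = m * c) :
    IsHilbertSamuelCoeffs 1 I ![(c : ℤ), (b : ℤ)] := by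
  refine isHilbertSamuelCoeffs_one_iff.mpr (Filter.eventually_atTop.mpr ⟨m₀, fun n hn => ?_⟩)
  have h1 := h (n + 1) (by omega)
  have h2 : Module.length R (R ⧸ I ^ (n + 1)) ≠ ⊤ := by
    intro h3
    rw [h3, top_add] at h1
    exact WithTop.mul_ne_top (ENat.natCast_ne_top _) (ENat.natCast_ne_top _) h1.symm
  refine ⟨_, (ENat.natCast_toNat h2).symm, ?_⟩
  rw [← ENat.natCast_toNat h2] at h1
  have h3 : (Module.length R (R ⧸ I ^ (n + 1))).toNat + b = (n + 1) * c := by exact_mod_cast h1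
  simp only [Matrix.cons_val_zero, Matrix.cons_val_one]
  have h4 : ((Module.length R (R ⧸ I ^ (n + 1))).toNat : ℤ) + b = (n + 1) * c := by
    exact_mod_cast h3
  linarith

end HilbertSamuel

/-! ### Subalgebras of the normalization compared by length -/

section Normalization

variable {R : Type u} [CommRing R] {K : Type*} [CommRing K] [Algebra R K]

theorem relLength_range_subalgebra (B : Subalgebra R K) :
    relLength (LinearMap.range (Algebra.linearMap R K)) (Subalgebra.toSubmodule B) =
      Module.length R (B ⧸ LinearMap.range (Algebra.linearMap R B)) := by
  have h := relLength_map (g := B.val.toLinearMap) Subtype.val_injective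
    (LinearMap.range (Algebra.linearMap R B)) ⊤
  rw [relLength_top, ← LinearMap.range_comp, Submodule.map_top] at h
  rw [← h]
  congr 1
  ext z
  exact ⟨fun hz => ⟨⟨z, hz⟩, rfl⟩, fun ⟨b, hb⟩ => hb ▸ b.2⟩

theorem range_le_toSubmodule (B : Subalgebra R K) :
    LinearMap.range (Algebra.linearMap R K) ≤ Subalgebra.toSubmodule B := by
  rintro _ ⟨r, rfl⟩
  exact B.algebraMap_mem r

theorem length_quotient_range_le {B C : Subalgebra R K} (h : B ≤ C) :
    Module.length R (B ⧸ LinearMap.range (Algebra.linearMap R B)) ≤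
      Module.length R (C ⧸ LinearMap.range (Algebra.linearMap R C)) := by
  rw [← relLength_range_subalgebra, ← relLength_range_subalgebra,
    relLength_add (range_le_toSubmodule B) (Subalgebra.toSubmodule.monotone h)]
  exact le_self_add

theorem eq_of_length_quotient_range_eq {B C : Subalgebra R K} (h : B ≤ C)
    (hB : Module.length R (B ⧸ LinearMap.range (Algebra.linearMap R B)) ≠ ⊤)
    (hBC : Module.length R (B ⧸ LinearMap.range (Algebra.linearMap R B)) =
      Module.length R (C ⧸ LinearMap.range (Algebra.linearMap R C))) : B = C := by
  rw [← relLength_range_subalgebra B, ← relLength_range_subalgebra C,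
    relLength_add (range_le_toSubmodule B) (Subalgebra.toSubmodule.monotone h)] at hBC
  rw [← relLength_range_subalgebra B] at hB
  have h0 : relLength (Subalgebra.toSubmodule B) (Subalgebra.toSubmodule C) = 0 :=
    ENat.add_right_injective_of_ne_top hB (hBC.symm.trans (add_zero _).symm)
  exact Subalgebra.toSubmodule_injective (eq_of_relLength_eq_zero h h0)

theorem le_integralClosure_of_finite (B : Subalgebra R K) [Module.Finite R B] :
    B ≤ integralClosure R K := fun z hz =>
  (Algebra.IsIntegral.isIntegral (R := R) (⟨z, hz⟩ : B)).map B.val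

end Normalization

/-! ### Reductions generated by a nonzerodivisor -/

section

variable {R : Type u} [CommRing R] [IsNoetherianRing R] [IsLocalRing R]

/-- For an ideal primary to the maximal ideal, some power `I ^ d` contains a nonzerodivisor `x`
that generates a reduction of `I ^ d`. -/
theorem exists_reduction_of_radical_eq [_root_.IsReduced R] (hdim : ringKrullDim R = 1) {I : Ideal R}
    (hI : I.radical = maximalIdeal R) : ∃ d, 0 < d ∧ ∃ x ∈ I ^ d, x ∈ R⁰ ∧
      ∃ m₀, ∀ m, m₀ ≤ m → I ^ (m + d) = Ideal.span {x} * I ^ m := by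
  obtain ⟨f, hf, hf0⟩ := exists_mem_maximalIdeal_nonZeroDivisors hdim
  have hrad : maximalIdeal R ≤ (Ideal.span {f}).radical :=
    maximalIdeal_le_radical_of_mem_nonZeroDivisors hdim hf0 (Ideal.mem_span_singleton_self f)
  have hfin : Module.length R (R ⧸ Ideal.span {f}) ≠ ⊤ := by
    refine length_ne_top_of_smul_eq_zero hrad fun r hr z => ?_
    obtain ⟨z, rfl⟩ := Ideal.Quotient.mk_surjective z
    exact Ideal.Quotient.eq_zero_iff_mem.mpr (Ideal.mul_mem_right _ _ hr)
  obtain ⟨d, hd, x, hx, m₀, h⟩ := exists_pow_add_eq_span_mul_pow hf hf0 hfin hI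
  refine ⟨d, hd, x, hx, ?_, m₀, h⟩
  -- A power of f lies in I^(m₀+d) = x I^m₀, so x divides a nonzerodivisor.
  obtain ⟨n, hn⟩ : f ∈ I.radical := hI ▸ hf
  have h1 : (f ^ n) ^ (m₀ + d) ∈ I ^ (m₀ + d) := Ideal.pow_mem_pow hn _
  rw [h m₀ le_rfl] at h1
  obtain ⟨c, -, hc⟩ := Ideal.mem_span_singleton_mul.mp h1
  have h2 := pow_mem (pow_mem hf0 n) (m₀ + d)
  rw [← hc] at h2
  exact (mul_mem_nonZeroDivisors.mp h2).1

end

/-! ### The blow-up as an affine scheme -/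

section BlowUp

theorem Localization.algebraMap_pow_mul_mk {A : Type*} [CommRing A] (f a : A) (n : ℕ) :
    algebraMap A (Localization.Away f) (f ^ n) * Localization.mk a ⟨f ^ n, pow_mem (Submonoid.mem_powers f) n⟩ =
      algebraMap A (Localization.Away f) a := by
  rw [Localization.mk_eq_mk']
  exact IsLocalization.mk'_spec' (Localization.Away f) a
    (⟨f ^ n, pow_mem (Submonoid.mem_powers f) n⟩ : Submonoid.powers f)

variable {R : Type u} [CommRing R] {I : Ideal R} {d : ℕ} {x : R}

theorem reesMonomial_mem_reesGrading (n : ℕ) (a : ↥(I ^ n)) :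
    reesMonomial I n a ∈ reesGrading I n := ⟨a, rfl⟩

theorem exists_reesMonomial_eq {n : ℕ} {z : reesAlgebra I} (hz : z ∈ reesGrading I n) :
    ∃ a : ↥(I ^ n), reesMonomial I n a = z := by
  obtain ⟨r, hr⟩ := hz
  refine ⟨⟨r, ?_⟩, Subtype.ext hr⟩
  have h := z.2
  change monomial n r = (z : R[X]) at hr
  rwa [← hr, reesAlgebra.monomial_mem] at h

theorem reesMonomial_pow {n : ℕ} (a : ↥(I ^ n)) (k : ℕ) : reesMonomial I n a ^ k =
    reesMonomial I (n * k) ⟨a ^ k, pow_mul I n k ▸ Ideal.pow_mem_pow a.2 k⟩ :=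
  Subtype.ext (monomial_pow n _ k)

/-- A high power of any homogeneous element of positive degree is divisible by x t^d. So a
homogeneous prime containing x t^d would contain the irrelevant ideal. -/
theorem Proj.basicOpen_reesMonomial_eq_top {m₀ : ℕ} (hx : x ∈ I ^ d)
    (hred : ∀ m, m₀ ≤ m → I ^ (m + d) = Ideal.span {x} * I ^ m) :
    Proj.basicOpen (reesGrading I) (reesMonomial I d ⟨x, hx⟩) = ⊤ := by
  classical
  refine top_le_iff.mp fun p _ => (Proj.mem_basicOpen _ _ p).mpr fun hp => ?_
  have hprime := p.isPrime
  refine p.not_irrelevant_le fun z hz => ?_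
  rw [← DirectSum.sum_support_decompose (reesGrading I) z]
  refine Ideal.sum_mem _ fun i _ => ?_
  rcases Nat.eq_zero_or_pos i with rfl | hi
  · have h0 : ((DirectSum.decompose (reesGrading I) z 0 : reesGrading I 0) : reesAlgebra I) = 0 :=
      hz
    rw [h0]
    exact zero_mem _
  obtain ⟨a, ha⟩ := exists_reesMonomial_eq (DirectSum.decompose (reesGrading I) z i).2
  rw [← ha]
  -- With this exponent the degree is at least m₀ + d, as i ≥ 1, and the reduction formula applies.
  refine hprime.mem_of_pow_mem (m₀ + d) ?_
  have hle : m₀ + d ≤ i * (m₀ + d) := Nat.le_mul_of_pos_left _ hi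
  obtain ⟨k, hk, hk'⟩ : ∃ k, m₀ ≤ k ∧ i * (m₀ + d) = k + d :=
    ⟨i * (m₀ + d) - d, by omega, by omega⟩
  have h1 : (a : R) ^ (m₀ + d) ∈ I ^ (k + d) := by
    rw [← hk', pow_mul]
    exact Ideal.pow_mem_pow a.2 _
  rw [hred k hk] at h1
  obtain ⟨c, hc, hc'⟩ := Ideal.mem_span_singleton_mul.mp h1
  have h2 : reesMonomial I i a ^ (m₀ + d) = reesMonomial I d ⟨x, hx⟩ * reesMonomial I k ⟨c, hc⟩ := by
    rw [reesMonomial_pow, reesMonomial_mul]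
    refine Subtype.ext ?_
    change monomial (i * (m₀ + d)) ((a : R) ^ (m₀ + d)) = monomial (d + k) (x * c)
    rw [hc', hk', add_comm]
  rw [h2]
  exact Ideal.mul_mem_right _ _ hp

variable (K : Type u) [CommRing K] [Algebra R K]

/-- Setting `t = 1` in the Rees algebra. -/
noncomputable def reesEvalOne (I : Ideal R) : reesAlgebra I →+* K :=
  ((aeval (1 : K) : R[X] →ₐ[R] K).comp (reesAlgebra I).val).toRingHom

theorem reesEvalOne_reesMonomial (n : ℕ) (a : ↥(I ^ n)) :
    reesEvalOne K I (reesMonomial I n a) = algebraMap R K a := by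
  change aeval (1 : K) (monomial n (a : R)) = _
  simp [aeval_monomial]

variable {K}

theorem isUnit_reesEvalOne (hx : x ∈ I ^ d) (hxu : IsUnit (algebraMap R K x)) :
    IsUnit (reesEvalOne K I (reesMonomial I d ⟨x, hx⟩)) := by
  rwa [reesEvalOne_reesMonomial]

/-- The degree-zero part of the localization of the Rees algebra at `x tᵈ`, mapped to a ring in
which `x` is a unit. -/
noncomputable def awayToUnit (hx : x ∈ I ^ d) (hxu : IsUnit (algebraMap R K x)) :
    HomogeneousLocalization.Away (reesGrading I) (reesMonomial I d ⟨x, hx⟩) →+* K :=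
  (Localization.awayLift (reesEvalOne K I) _ (isUnit_reesEvalOne hx hxu)).comp
    (algebraMap _ (Localization.Away (reesMonomial I d ⟨x, hx⟩)))

theorem pow_mul_awayToUnit (hx : x ∈ I ^ d) (hxu : IsUnit (algebraMap R K x)) (n : ℕ)
    (a : reesAlgebra I) (ha : a ∈ reesGrading I (n • d)) :
    algebraMap R K x ^ n * awayToUnit hx hxu (HomogeneousLocalization.Away.mk (reesGrading I)
      (reesMonomial_mem_reesGrading d ⟨x, hx⟩) n a ha) = reesEvalOne K I a := by
  have h : algebraMap (reesAlgebra I) (Localization.Away (reesMonomial I d ⟨x, hx⟩))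
      (reesMonomial I d ⟨x, hx⟩ ^ n) * (HomogeneousLocalization.Away.mk (reesGrading I)
      (reesMonomial_mem_reesGrading d ⟨x, hx⟩) n a ha).val = algebraMap _ _ a := by
    rw [HomogeneousLocalization.Away.val_mk]
    exact Localization.algebraMap_pow_mul_mk _ a n
  have h1 := congrArg (Localization.awayLift (reesEvalOne K I) _ (isUnit_reesEvalOne hx hxu)) h
  rw [map_mul] at h1
  have h2 : ∀ b, Localization.awayLift (reesEvalOne K I) _ (isUnit_reesEvalOne hx hxu)
      (algebraMap _ _ b) = reesEvalOne K I b := fun b => IsLocalization.Away.lift_eq _ _ b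
  rw [h2, h2, map_pow, reesEvalOne_reesMonomial] at h1
  exact h1

theorem injective_awayToUnit (hx : x ∈ I ^ d) (hxu : IsUnit (algebraMap R K x))
    (hinj : Function.Injective (algebraMap R K)) : Function.Injective (awayToUnit hx hxu) := by
  refine (injective_iff_map_eq_zero _).mpr fun z hz => ?_
  obtain ⟨n, a, ha, rfl⟩ :=
    HomogeneousLocalization.Away.mk_surjective (reesGrading I) (reesMonomial_mem_reesGrading d ⟨x, hx⟩) z
  have h := pow_mul_awayToUnit hx hxu n a ha
  obtain ⟨r, rfl⟩ := exists_reesMonomial_eq ha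
  rw [hz, mul_zero, reesEvalOne_reesMonomial] at h
  have hr : r = 0 := Subtype.ext (hinj (h.symm.trans (map_zero _).symm))
  refine HomogeneousLocalization.val_injective _ ?_
  rw [HomogeneousLocalization.Away.val_mk, HomogeneousLocalization.val_zero, hr, map_zero,
    Localization.mk_zero]

theorem mem_range_awayToUnit (hx : x ∈ I ^ d) (hxu : IsUnit (algebraMap R K x)) (z : K) :
    z ∈ Set.range (awayToUnit hx hxu) ↔ z ∈ blowUpAlgebra K hx := by
  constructor
  · rintro ⟨z, rfl⟩
    obtain ⟨n, a, ha, rfl⟩ := HomogeneousLocalization.Away.mk_surjective (reesGrading I)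
      (reesMonomial_mem_reesGrading d ⟨x, hx⟩) z
    have h := pow_mul_awayToUnit hx hxu n a ha
    obtain ⟨r, rfl⟩ := exists_reesMonomial_eq ha
    rw [reesEvalOne_reesMonomial] at h
    exact ⟨n, r, by rw [mul_comm]; exact r.2, h⟩
  · rintro ⟨n, r, hr, h⟩
    have hr' : r ∈ I ^ (n • d) := by rwa [smul_eq_mul, mul_comm]
    refine ⟨HomogeneousLocalization.Away.mk (reesGrading I)
      (reesMonomial_mem_reesGrading d ⟨x, hx⟩) n (reesMonomial I (n • d) ⟨r, hr'⟩)
      (reesMonomial_mem_reesGrading _ _), (hxu.pow n).mul_left_cancel ?_⟩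
    rw [pow_mul_awayToUnit, reesEvalOne_reesMonomial, h]

theorem awayToUnit_fromZeroRingHom (hx : x ∈ I ^ d) (hxu : IsUnit (algebraMap R K x)) (r : R) :
    awayToUnit hx hxu (HomogeneousLocalization.fromZeroRingHom (reesGrading I) _
      (algebraMap R (reesGrading I 0) r)) = algebraMap R K r := by
  have h0 : HomogeneousLocalization.fromZeroRingHom (reesGrading I)
      (Submonoid.powers (reesMonomial I d ⟨x, hx⟩)) (algebraMap R (reesGrading I 0) r) =
      HomogeneousLocalization.Away.mk (reesGrading I) (reesMonomial_mem_reesGrading d ⟨x, hx⟩) 0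
        (algebraMap R (reesAlgebra I) r) (by
          rw [zero_smul]
          exact ((algebraMap R (reesGrading I 0)) r).2) := by
    refine HomogeneousLocalization.val_injective _ ?_
    rw [HomogeneousLocalization.Away.val_mk]
    exact congrArg (Localization.mk _) (Subtype.ext (pow_zero _).symm)
  have h := pow_mul_awayToUnit hx hxu 0 (algebraMap R (reesAlgebra I) r) (by
          rw [zero_smul]
          exact ((algebraMap R (reesGrading I 0)) r).2)
  rw [h0, ← one_mul (awayToUnit _ _ _), ← pow_zero (algebraMap R K x), h]
  change aeval (1 : K) (algebraMap R R[X] r) = _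
  simp

/-- When `x ∈ Iᵈ` generates a reduction of `Iᵈ`, the blow-up of `I` is the spectrum of
`⋃ k, x⁻ᵏ I ^ (d * k)`. -/
theorem exists_iso_blowUpMap_eq {m₀ : ℕ} (hd : 0 < d) (hx : x ∈ I ^ d)
    (hred : ∀ m, m₀ ≤ m → I ^ (m + d) = Ideal.span {x} * I ^ m)
    (hinj : Function.Injective (algebraMap R K)) (hxu : IsUnit (algebraMap R K x)) :
    ∃ e : Proj (reesGrading I) ≅ Spec (CommRingCat.of (blowUpAlgebra K hx)),
      blowUpMap I = e.hom ≫ Spec.map (CommRingCat.ofHom (algebraMap R (blowUpAlgebra K hx))) := by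
  let A := HomogeneousLocalization.Away (reesGrading I) (reesMonomial I d ⟨x, hx⟩)
  let φ : A →+* blowUpAlgebra K hx := (awayToUnit hx hxu).codRestrict (blowUpAlgebra K hx)
    fun z => (mem_range_awayToUnit hx hxu _).mp ⟨z, rfl⟩
  have hφ : Function.Bijective φ := by
    refine ⟨fun a b h => injective_awayToUnit hx hxu hinj (congrArg Subtype.val h), fun z => ?_⟩
    obtain ⟨a, ha⟩ := (mem_range_awayToUnit hx hxu _).mpr z.2
    exact ⟨a, Subtype.ext ha⟩
  let ε : CommRingCat.of A ≅ CommRingCat.of (blowUpAlgebra K hx) :=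
    (RingEquiv.ofBijective φ hφ).toCommRingCatIso
  let ι := Proj.awayι (reesGrading I) _ (reesMonomial_mem_reesGrading d ⟨x, hx⟩) hd
  have hι : IsIso ι := by
    have h : ι.opensRange = ⊤ := (Proj.opensRange_awayι _ _ _ _).trans
      (Proj.basicOpen_reesMonomial_eq_top hx hred)
    exact isIso_of_isOpenImmersion_of_opensRange_eq_top ι h
  have hcomp : CommRingCat.ofHom (algebraMap R (blowUpAlgebra K hx)) =
      CommRingCat.ofHom (algebraMap R (reesGrading I 0)) ≫ CommRingCat.ofHom (R := reesGrading I 0)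
        (S := A) (HomogeneousLocalization.fromZeroRingHom (reesGrading I) _) ≫ ε.hom := by
    ext r
    exact (awayToUnit_fromZeroRingHom hx hxu r).symm
  refine ⟨(asIso ι).symm ≪≫ (asIso (Spec.map ε.hom)).symm, ?_⟩
  have h2 : Spec.map (CommRingCat.ofHom (R := reesGrading I 0) (S := A)
      (HomogeneousLocalization.fromZeroRingHom (reesGrading I)
      (Submonoid.powers (reesMonomial I d ⟨x, hx⟩)))) = ι ≫ Proj.toSpecZero (reesGrading I) :=
    (Proj.awayι_toSpecZero _ _ _ _).symm
  rw [hcomp, Spec.map_comp, Spec.map_comp, h2]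
  change _ = (inv ι ≫ inv (Spec.map ε.hom)) ≫ _
  rw [Category.assoc, Category.assoc, IsIso.inv_hom_id_assoc, Category.assoc,
    IsIso.inv_hom_id_assoc]
  rfl

end BlowUp

/-! ### Resolutions and the first Hilbert coefficient -/

section Resolution

variable {R : Type u} [CommRing R] [IsLocalRing R]

theorem zeroLocus_eq_of_radical_eq {I : Ideal R} (hI : I.radical = maximalIdeal R) :
    PrimeSpectrum.zeroLocus (I : Set R) = {closedPoint R} := by
  ext p
  rw [PrimeSpectrum.mem_zeroLocus, SetLike.coe_subset_coe, ← p.2.radical_le_iff, hI]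
  refine ⟨fun h => ?_, ?_⟩
  · exact PrimeSpectrum.ext ((maximalIdeal.isMaximal R).eq_of_le p.2.ne_top h).symm
  · rintro rfl
    exact le_rfl

variable [_root_.IsReduced R]

theorem isHironakaIdeal_of_isResolution (hdim : ringKrullDim R = 1) {I : Ideal R}
    (hI : I.radical = maximalIdeal R) (h : IsResolution (blowUpMap I))
    (hreg : ¬ IsRegularLocalRing R) : IsHironakaIdeal I where
  zeroLocus_eq := (zeroLocus_eq_of_radical_eq hI).trans
    (singularLocus_Spec_of_not_isRegularLocalRing hdim hreg).symm
  resolution := h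

variable [IsNoetherianRing R]

theorem exists_isResolution_of_singularityOrder_ne_top (hdim : ringKrullDim R = 1)
    (h : singularityOrder R ≠ ⊤) :
    ∃ (Z : Scheme.{u}) (π : Z ⟶ Spec (CommRingCat.of R)), IsResolution π := by
  have := finite_integralClosure_of_singularityOrder_ne_top h
  exact ⟨_, _, isResolution_specMap_of_algEquiv_integralClosure hdim AlgEquiv.refl⟩

/-- The Hilbert coefficient `e₁` of an ideal primary to the maximal ideal is the colength of `R` in
a finite birational extension whose spectrum is the blow-up of the ideal. -/
theorem exists_isHilbertSamuelCoeffs (hdim : ringKrullDim R = 1) {I : Ideal R}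
    (hI : I.radical = maximalIdeal R) : ∃ b c : ℕ, IsHilbertSamuelCoeffs 1 I ![(c : ℤ), (b : ℤ)] ∧
      (b : ℕ∞) ≤ singularityOrder R ∧
        ((b : ℕ∞) = singularityOrder R → IsResolution (blowUpMap I)) := by
  obtain ⟨d, hd, x, hx, hx0, m₀, hred⟩ := exists_reduction_of_radical_eq hdim hI
  have hinj : Function.Injective (algebraMap R (FractionRing R)) :=
    IsFractionRing.injective R (FractionRing R)
  have hxu : IsUnit (algebraMap R (FractionRing R) x) :=
    IsLocalization.map_units (FractionRing R) (⟨x, hx0⟩ : R⁰)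
  obtain ⟨b, c, hb, hbc⟩ :=
    length_quotient_pow_add_length_quotient_range hred hI hx hd hinj hxu
  have hfin := finite_blowUpAlgebra hred hx hd hxu
  have hle := le_integralClosure_of_finite (blowUpAlgebra (FractionRing R) hx)
  refine ⟨b, c, isHilbertSamuelCoeffs_of_length_add_eq hbc, ?_, fun h => ?_⟩
  · rw [← hb]
    exact length_quotient_range_le hle
  · have heq : blowUpAlgebra (FractionRing R) hx = integralClosure R (FractionRing R) :=
      eq_of_length_quotient_range_eq hle (hb ▸ ENat.natCast_ne_top b) (hb.trans h)
    obtain ⟨e, he⟩ := exists_iso_blowUpMap_eq hd hx hred hinj hxu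
    rw [he]
    exact (isResolution_specMap_of_algEquiv_integralClosure hdim
      (Subalgebra.equivOfEq _ _ heq)).iso_comp e

end Resolution

/-! ### Finiteness of δ in characteristic zero -/

section FiniteNormalization

/-- A domain essentially of finite type over a field of characteristic zero has a finite
normalization. -/
theorem finite_integralClosure_of_essFiniteType_of_isDomain (k D L : Type*) [Field k]
    [CharZero k] [CommRing D] [IsDomain D] [Algebra k D] [Algebra.EssFiniteType k D] [Field L] [Algebra D L]
    [IsFractionRing D L] : Module.Finite D (integralClosure D L) := by
  -- D is a localization of the finitely generated algebra D₀, which is finite over a polynomial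
  -- ring P.
  let D₀ := Algebra.EssFiniteType.subalgebra k D
  let S := Algebra.EssFiniteType.submonoid k D
  obtain ⟨s, g, hg, hgfin⟩ := exists_finite_inj_algHom_of_fg k D₀
  let P := MvPolynomial (Fin s) k
  let F := FractionRing P
  let _ : Algebra P D₀ := g.toRingHom.toAlgebra
  let _ : Algebra P D := ((algebraMap D₀ D).comp g.toRingHom).toAlgebra
  let _ : Algebra P L := ((algebraMap D L).comp (algebraMap P D)).toAlgebra
  let _ : Algebra k L := ((algebraMap D L).comp (algebraMap k D)).toAlgebra
  have : IsScalarTower P D₀ D := .of_algebraMap_eq' rfl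
  have : IsScalarTower P D L := .of_algebraMap_eq' rfl
  have : IsScalarTower k D L := .of_algebraMap_eq' rfl
  have : IsScalarTower k P D := .of_algebraMap_eq fun r => by
    change algebraMap k D r = algebraMap D₀ D (g (algebraMap k P r))
    rw [g.commutes]
    rfl
  have : IsScalarTower k P L := .of_algebraMap_eq fun r => by
    rw [IsScalarTower.algebraMap_apply k D L, IsScalarTower.algebraMap_apply P D L,
      IsScalarTower.algebraMap_apply k P D]
  have : IsScalarTower D₀ D L := inferInstance
  have : IsScalarTower P D₀ L := .of_algebraMap_eq fun r => rfl
  have hPD₀ : Module.Finite P D₀ := hgfin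
  have hinjD : Function.Injective (algebraMap D₀ L) :=
    (IsFractionRing.injective D L).comp Subtype.val_injective
  have hinjP : Function.Injective (algebraMap P L) := hinjD.comp hg
  have : FaithfulSMul D₀ L := (faithfulSMul_iff_algebraMap_injective _ _).mpr hinjD
  have : FaithfulSMul P L := (faithfulSMul_iff_algebraMap_injective _ _).mpr hinjP
  have : FaithfulSMul P D₀ := (faithfulSMul_iff_algebraMap_injective _ _).mpr hg
  have : IsFractionRing D₀ L := by
    refine IsFractionRing.of_field D₀ L fun z => ?_
    obtain ⟨a, b, hb, rfl⟩ := IsFractionRing.div_surjective (A := D) z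
    obtain ⟨⟨a', m⟩, ha⟩ := IsLocalization.surj S a
    obtain ⟨⟨b', n⟩, hb'⟩ := IsLocalization.surj S b
    refine ⟨a' * n, b' * m, ?_⟩
    have hm := (IsLocalization.map_units D m).ne_zero
    have hn := (IsLocalization.map_units D n).ne_zero
    have hb0 : b ≠ 0 := nonZeroDivisors.ne_zero hb
    have hinj := IsFractionRing.injective D L
    have hne : ∀ y : D, y ≠ 0 → algebraMap D L y ≠ 0 := fun y hy =>
      (map_ne_zero_iff _ hinj).mpr hy
    rw [IsScalarTower.algebraMap_apply D₀ D L, IsScalarTower.algebraMap_apply D₀ D L,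
      map_mul (algebraMap D₀ D), map_mul (algebraMap D₀ D),
      ← ha, ← hb', div_eq_div_iff (hne b hb0) (hne _ (mul_ne_zero (mul_ne_zero hb0 hn) hm)),
      ← map_mul, ← map_mul]
    congr 1
    ring
  let _ : Algebra F L := FractionRing.liftAlgebra P L
  have : IsScalarTower P F L := inferInstance
  have : Algebra.IsAlgebraic F L := isAlgebraic_of_isFractionRing P D₀ F L
  have : Algebra.EssFiniteType k L :=
    have := Algebra.EssFiniteType.of_isLocalization L D⁰
    Algebra.EssFiniteType.comp k D L
  have : IsScalarTower k F L := .to₁₃₄ k P F L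
  have : Algebra.EssFiniteType F L := Algebra.EssFiniteType.of_comp k F L
  have : FiniteDimensional F L := Algebra.finite_of_essFiniteType_of_isAlgebraic
  -- Characteristic zero enters here: L is finite separable over Frac P, and P is Noetherian and
  -- integrally closed.
  have hC : Module.Finite P (integralClosure P L) := IsIntegralClosure.finite P F L _
  obtain ⟨t, ht⟩ := (Module.Finite.iff_fg (N := Subalgebra.toSubmodule (integralClosure P L))).mp hC
  suffices (Subalgebra.toSubmodule (integralClosure D L)).FG from Module.Finite.of_fg this
  refine ⟨t, le_antisymm (Submodule.span_le.mpr fun z hz => ?_) fun z hz => ?_⟩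
  · have h : z ∈ Submodule.span P (t : Set L) := Submodule.subset_span hz
    rw [ht] at h
    exact IsIntegral.tower_top (R := P) h
  -- Clearing denominators makes mz integral over D₀, hence over P, and m is a unit in D.
  · obtain ⟨m, hm⟩ := IsIntegral.exists_multiple_integral_of_isLocalization S z hz
    have h : (m • z : L) ∈ Submodule.span P (t : Set L) := by
      rw [ht]
      exact isIntegral_trans (A := D₀) _ hm
    have h' : (m • z : L) ∈ Submodule.span D (t : Set L) := Submodule.span_le_restrictScalars P D _ h
    obtain ⟨u, hu⟩ := (IsLocalization.map_units D m).exists_left_inv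
    have h2 : z = u • (m • z : L) := by
      have h3 : (m • z : L) = algebraMap D L (algebraMap D₀ D m) * z := by
        rw [← IsScalarTower.algebraMap_apply D₀ D L]
        exact Algebra.smul_def (m : D₀) z
      rw [h3, Algebra.smul_def, ← mul_assoc, ← map_mul, hu, map_one, one_mul]
    rw [h2]
    exact Submodule.smul_mem _ _ h'

/-- The integral closure of a reduced Noetherian ring in its total ring of fractions is finite as
soon as this holds for the quotients by the minimal primes. -/
theorem finite_integralClosure_fractionRing {R : Type*} [CommRing R] [IsNoetherianRing R]
    [_root_.IsReduced R] (h : ∀ p : Ideal R, p.IsPrime →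
      Module.Finite (R ⧸ p) (integralClosure (R ⧸ p) (FractionRing (R ⧸ p)))) :
    Module.Finite R (integralClosure R (FractionRing R)) := by
  let ι := minimalPrimes R
  have : Finite ι := minimalPrimes.finite_of_isNoetherianRing R
  have hprime : ∀ p : ι, p.1.IsPrime := fun p => p.2.1.1
  let L : ι → Type _ := fun p => FractionRing (R ⧸ p.1)
  have hunit : ∀ (p : ι) (y : R⁰), IsUnit (algebraMap R (L p) y) := by
    intro p y
    have hy : (y : R) ∉ p.1 := fun hy =>
      Set.disjoint_left.mp (Ideal.disjoint_nonZeroDivisors_of_mem_minimalPrimes p.2) hy y.2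
    rw [IsScalarTower.algebraMap_apply R (R ⧸ p.1) (L p)]
    refine isUnit_iff_ne_zero.mpr ((map_ne_zero_iff _ (IsFractionRing.injective _ _)).mpr ?_)
    exact fun h0 => hy (Ideal.Quotient.eq_zero_iff_mem.mp h0)
  let φ : ∀ p : ι, FractionRing R →ₐ[R] L p := fun p =>
    IsLocalization.liftAlgHom (M := R⁰) (f := Algebra.ofId R (L p)) (hunit p)
  have hfin : ∀ p, Module.Finite R (integralClosure (R ⧸ p.1) (L p)) := fun p =>
    have := h p.1 (hprime p)
    Module.Finite.trans (R ⧸ p.1) _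
  -- R̄ embeds into the product of the normalizations of the branches. The numerator of an element
  -- of the kernel lies in every minimal prime, so it vanishes.
  let ψ : integralClosure R (FractionRing R) →ₗ[R] ∀ p : ι, integralClosure (R ⧸ p.1) (L p) :=
    LinearMap.pi fun p => LinearMap.codRestrict
      ((Subalgebra.toSubmodule (integralClosure (R ⧸ p.1) (L p))).restrictScalars R)
      ((φ p).toLinearMap.comp (integralClosure R (FractionRing R)).val.toLinearMap) fun z =>
        IsIntegral.tower_top (R := R) (z.2.map (φ p))
  refine Module.Finite.of_injective ψ ((injective_iff_map_eq_zero _).mpr fun z hz => ?_)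
  have hz' : ∀ p, φ p z = 0 := fun p => congrArg Subtype.val (congrFun hz p)
  obtain ⟨⟨a, s⟩, has⟩ := IsLocalization.surj R⁰ (z : FractionRing R)
  have ha : a = 0 := by
    have hmem : a ∈ nilradical R := by
      rw [nilradical, ← Ideal.sInf_minimalPrimes, Ideal.mem_sInf]
      intro p hp
      have h1 := congrArg (φ ⟨p, hp⟩) has
      rw [map_mul, hz', zero_mul, AlgHom.commutes,
        IsScalarTower.algebraMap_apply R (R ⧸ p) (FractionRing (R ⧸ p))] at h1
      have h2 := (map_eq_zero_iff _ (IsFractionRing.injective (R ⧸ p) (FractionRing (R ⧸ p)))).mp h1.symm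
      exact Ideal.Quotient.eq_zero_iff_mem.mp h2
    rwa [nilradical_eq_zero] at hmem
  rw [ha, map_zero] at has
  exact Subtype.ext ((IsLocalization.map_units (FractionRing R) s).mul_left_eq_zero.mp has)

/-- A common denominator s of finitely many generators kills R̄/R, and R/(s) is Artinian. -/
theorem singularityOrder_ne_top_of_finite {R : Type u} [CommRing R] [IsNoetherianRing R]
    [IsLocalRing R] [_root_.IsReduced R] (hdim : ringKrullDim R = 1)
    [hfin : Module.Finite R (integralClosure R (FractionRing R))] : singularityOrder R ≠ ⊤ := by
  classical
  obtain ⟨t, ht⟩ := id hfin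
  obtain ⟨s, hs⟩ := IsLocalization.exist_integer_multiples_of_finset R⁰
    (t.image Subtype.val : Finset (FractionRing R))
  refine length_ne_top_of_smul_eq_zero (J := Ideal.span {(s : R)})
    (maximalIdeal_le_radical_of_mem_nonZeroDivisors hdim s.2 (Ideal.mem_span_singleton_self _)) ?_
  have key : ∀ z : integralClosure R (FractionRing R), (s : R) • z ∈ LinearMap.range
      (Algebra.linearMap R (integralClosure R (FractionRing R))) := by
    intro z
    have hz : z ∈ Submodule.span R (t : Set _) := ht ▸ Submodule.mem_top
    induction hz using Submodule.span_induction with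
    | mem y hy =>
      obtain ⟨r, hr⟩ := hs y (Finset.mem_image_of_mem _ hy)
      exact ⟨r, Subtype.ext hr⟩
    | zero => rw [smul_zero]; exact zero_mem _
    | add y z _ _ hy hz => rw [smul_add]; exact add_mem hy hz
    | smul r y _ hy => rw [smul_comm]; exact Submodule.smul_mem _ r hy
  intro r hr z
  obtain ⟨c, rfl⟩ := Ideal.mem_span_singleton.mp hr
  obtain ⟨z, rfl⟩ := Submodule.mkQ_surjective _ z
  rw [mul_comm, mul_smul, ← map_smul, Submodule.mkQ_apply,
    (Submodule.Quotient.mk_eq_zero _).mpr (key z), smul_zero]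

theorem singularityOrder_ne_top_of_essFiniteType {R : Type u} [CommRing R] [IsNoetherianRing R]
    [IsLocalRing R] [_root_.IsReduced R] (hdim : ringKrullDim R = 1) (k : Type*) [Field k]
    [CharZero k] [Algebra k R] [Algebra.EssFiniteType k R] : singularityOrder R ≠ ⊤ := by
  have := finite_integralClosure_fractionRing (R := R) fun p hp =>
    finite_integralClosure_of_essFiniteType_of_isDomain k (R ⧸ p) (FractionRing (R ⧸ p))
  exact singularityOrder_ne_top_of_finite hdim

end FiniteNormalization

theorem proposition4p2 {R : Type u} [CommRing R] [IsNoetherianRing R] [IsLocalRing R]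
    [_root_.IsReduced R] (hdim : ringKrullDim R = 1) :
    (∀ {Z : Scheme.{u}} (π : Z ⟶ Spec (CommRingCat.of R)), IsResolution π →
      genusOf π = singularityOrder R) ∧
    (singularityOrder R ≠ ⊤ →
      ∃ (Z : Scheme.{u}) (π : Z ⟶ Spec (CommRingCat.of R)), IsResolution π) ∧
    (∀ (k : Type u) [Field k] [CharZero k] [Algebra k R] [Algebra.EssFiniteType k R],
      singularityOrder R ≠ ⊤) ∧
    ∀ I : Ideal R, I.radical = IsLocalRing.maximalIdeal R →
      (∃! e : Fin 2 → ℤ, IsHilbertSamuelCoeffs 1 I e) ∧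
      ∀ e : Fin 2 → ℤ, IsHilbertSamuelCoeffs 1 I e →
        0 ≤ e 1 ∧
        ((e 1).toNat : ℕ∞) ≤ singularityOrder R ∧
        (((e 1).toNat : ℕ∞) = singularityOrder R →
          IsResolution (blowUpMap I) ∧
          (¬ IsRegularLocalRing R → IsHironakaIdeal I)) := by
  refine ⟨fun π h => genusOf_eq_singularityOrder π hdim h,
    exists_isResolution_of_singularityOrder_ne_top hdim,
    fun k _ _ _ _ => singularityOrder_ne_top_of_essFiniteType hdim k, fun I hI => ?_⟩
  obtain ⟨b, c, he, hle, hres⟩ := exists_isHilbertSamuelCoeffs hdim hI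
  refine ⟨⟨_, he, fun e' he' => he'.eq_of_one he⟩, fun e he' => ?_⟩
  -- By uniqueness e 1 is the natural number b, so `toNat` loses nothing.
  obtain rfl := he'.eq_of_one he
  refine ⟨Int.natCast_nonneg b, hle, fun h => ?_⟩
  exact ⟨hres h, isHironakaIdeal_of_isResolution hdim hI (hres h)⟩
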